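/- Let $\mathbb F$ be a field. For a finite simplicial complex $C$ on a finite ground set $V$ (a family of subsets of $V$ closed under taking subsets; the empty set is a face) and an integer $i\ge -1$ put \[ \tau_i(C)=\frac1{|V|+1}\sum_{W\subseteq V}\frac{\tilde\beta_i(C[W])}{\binom{|V|}{|W|}}, \] where $C[W]=\{F\in C: F\subseteq W\}$ is the induced subcomplex and $\tilde\beta_i$ is the $i$-th reduced Betti number over $\mathbb F$ (so $\tilde\beta_{-1}=1$ and $\tilde\beta_0=0$ for the complex whose only face is $\emptyset$). The ground set may be any finite set containing all vertices of $C$. A combinatorial $d$-manifold is a finite, closed, connected one, i.e. a pure $d$-dimensional, strongly connected simplicial complex in which every $(d-1)$-face lies in exactly two facets and the link of every vertex is PL-homeomorphic to the boundary of the $d$-simplex. It is $\mathbb F$-orientable if its facets can be given signs $\pm1$ so that the signed sum of all facets is a cycle over $\mathbb F$ (always true if $\operatorname{char}\mathbb F=2$, and equivalent to orientability otherwise). A stacking move (bistellar flip of type $(1,d+1)$) chooses a facet $D$ and an element $v$ that is not a vertex of the complex, removes the face $D$, and inserts all sets $\{v\}\cup G$ with $G\subsetneq D$. Let $d\ge 2$,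 let $M$ be a combinatorial $d$-manifold with $n$ vertices, and let $N$ be obtained from $M$ by $k\ge 0$ successive stacking moves. Then \[ \tau_j(N)=\tau_j(M)+\frac{k}{(d+2)(d+3)}-\frac1{n+1}+\frac1{n+k+1} \] for $j=0$, and, if $M$ is $\mathbb F$-orientable, also for $j=d-1$. Moreover $\tau_i(N)=\tau_i(M)$ for all $1\le i\le d-2$. -/

import Mathlib

noncomputable section

/-!
A finite (abstract) simplicial complex on vertices of type `α` is a `PreAbstractSimplicialComplex α`
with finitely many faces. Mathlib stores only the nonempty faces; the empty face, which every
complex has by convention, is added in `augFaces`.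
-/

/-- A map `f` restricts to a piecewise linear homeomorphism between the polyhedra of the geometric
simplicial complexes `K` and `L`: it is a bijection of the polyhedra, and it is affine on
every simplex of some finite subdivision `K'` of `K`. (For finite complexes such a bijection is
automatically continuous, its inverse is continuous by compactness, and is again piecewise
linear.) -/
def Geometry.SimplicialComplex.IsPLHomeomorphism {E E' : Type*} [AddCommGroup E] [Module ℝ E]
    [AddCommGroup E'] [Module ℝ E'] (K : Geometry.SimplicialComplex ℝ E)
    (L : Geometry.SimplicialComplex ℝ E') (f : E → E') : Prop :=
  Set.BijOn f K.space L.space ∧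
    ∃ K' : Geometry.SimplicialComplex ℝ E, K'.faces.Finite ∧ K'.space = K.space ∧
      (∀ s ∈ K'.faces, ∃ t ∈ K.faces, convexHull ℝ (s : Set E) ⊆ convexHull ℝ (t : Set E)) ∧
      ∀ s ∈ K'.faces, ∃ g : E →ᵃ[ℝ] E', Set.EqOn f g (convexHull ℝ (s : Set E))

namespace PreAbstractSimplicialComplex

/-- The boundary complex of the `m`-simplex: all nonempty proper subsets of an `(m+1)`-element
set. Its realization is the standard piecewise linear `(m-1)`-sphere. -/
def simplexBoundary (m : ℕ) : PreAbstractSimplicialComplex (Fin (m + 1)) where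
  faces := {s | s.Nonempty ∧ s ≠ Finset.univ}
  isRelLowerSet_faces := by
    rintro s ⟨hs, hs'⟩
    refine ⟨hs, fun t hts ht => ⟨ht, ?_⟩⟩
    rintro rfl
    exact hs' (Finset.univ_subset_iff.mp hts)

/-- The abstract simplicial complexes `K` and `L` (both finite) have piecewise linearly
homeomorphic geometric realizations. -/
def PLHomeomorphic {α β : Type*} [DecidableEq α] [DecidableEq β]
    (K : PreAbstractSimplicialComplex α) (L : PreAbstractSimplicialComplex β) : Prop :=
  ∃ f : (α →₀ ℝ) → (β →₀ ℝ),
    (Geometry.SimplicialComplex.onFinsupp (𝕜 := ℝ) K).IsPLHomeomorphism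
      (Geometry.SimplicialComplex.onFinsupp (𝕜 := ℝ) L) f

variable {α : Type*}

/-- The set of vertices of a simplicial complex. -/
def vertexSet (K : PreAbstractSimplicialComplex α) : Set α := {v | {v} ∈ K.faces}

/-- All faces of `K`, including the empty face. -/
def augFaces (K : PreAbstractSimplicialComplex α) : Set (Finset α) := insert ∅ K.faces

/-- The subcomplex `K[W]` of `K` induced by a set `W`: all faces contained in `W`. -/
def induced (K : PreAbstractSimplicialComplex α) (W : Finset α) :
    PreAbstractSimplicialComplex α where
  faces := {s ∈ K.faces | s ⊆ W}
  isRelLowerSet_faces := fun {_} hs =>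
    ⟨(K.isRelLowerSet_faces hs.1).1, fun _ hts ht =>
      ⟨(K.isRelLowerSet_faces hs.1).2 hts ht, Finset.Subset.trans hts hs.2⟩⟩

section LinearOrder

variable [LinearOrder α]

/-- The link of a vertex `v` in `K`. -/
def link (K : PreAbstractSimplicialComplex α) (v : α) : PreAbstractSimplicialComplex α where
  faces := {s | s.Nonempty ∧ v ∉ s ∧ insert v s ∈ K.faces}
  isRelLowerSet_faces := fun {_} hs =>
    ⟨hs.1, fun _ hts ht => ⟨ht, fun hv => hs.2.1 (hts hv),
      (K.isRelLowerSet_faces hs.2.2).2 (Finset.insert_subset_insert v hts)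
        (Finset.insert_nonempty _ _)⟩⟩

/-! ### Manifolds -/

/-- The `d`-dimensional faces of `K`; in a pure `d`-dimensional complex these are the facets. -/
def dFaces (K : PreAbstractSimplicialComplex α) (d : ℕ) : Set (Finset α) :=
  {s ∈ K.faces | s.card = d + 1}

/-- The adjacency graph (dual graph) of a pure `d`-dimensional complex: its nodes are the facets,
and two facets are adjacent if they share a common ridge. -/
def dualGraph (K : PreAbstractSimplicialComplex α) (d : ℕ) : SimpleGraph (K.dFaces d) where
  Adj s t := s ≠ t ∧ ((s : Finset α) ∩ t).card = d
  symm := ⟨fun _ _ h => ⟨h.1.symm, by rw [Finset.inter_comm]; exact h.2⟩⟩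
  loopless := ⟨fun _ h => h.1 rfl⟩

/-- A (closed) `d`-dimensional pseudo-manifold: a finite simplicial complex that is pure of
dimension `d`, strongly connected, and in which every ridge lies in exactly two facets. -/
structure IsPseudoManifold (d : ℕ) (K : PreAbstractSimplicialComplex α) : Prop where
  finite : K.faces.Finite
  pure : ∀ s ∈ K.faces, ∃ t ∈ K.dFaces d, s ⊆ t
  stronglyConnected : (K.dualGraph d).Connected
  ridge : ∀ r ∈ K.faces, r.card = d → {t ∈ K.dFaces d | r ⊆ t}.ncard = 2

/-- A (closed, connected) combinatorial `d`-manifold: a pseudo-manifold in which the link of every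
vertex is piecewise linearly homeomorphic to the standard `(d-1)`-sphere, the boundary of the
`d`-simplex. -/
structure IsCombinatorialManifold (d : ℕ) (K : PreAbstractSimplicialComplex α) : Prop
    extends IsPseudoManifold d K where
  link_sphere : ∀ v ∈ K.vertexSet, PLHomeomorphic (K.link v) (simplexBoundary d)

/-! ### Bistellar flips -/

/-- The complex `B_{F,G}` with vertex set in `F` and unique minimal non-face `G ⊆ F`. -/
def flipBall (F G : Finset α) : PreAbstractSimplicialComplex α where
  faces := {s | s.Nonempty ∧ s ⊆ F ∧ ¬ G ⊆ s}
  isRelLowerSet_faces := fun {_} hs =>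
    ⟨hs.1, fun _ hts ht => ⟨ht, Finset.Subset.trans hts hs.2.1,
      fun h => hs.2.2 (Finset.Subset.trans h hts)⟩⟩

/-- `M₂` is obtained from `M₁` by a bistellar flip of type `(i, j)`: there are disjoint
nonempty sets `F₁`, `F₂` with `i` and `j` elements such that, for `F = F₁ ∪ F₂`, the induced
subcomplex `M₁[F]` is `B_{F,F₁}`, and `M₂` arises by replacing `B_{F,F₁}` with `B_{F,F₂}`,
i.e. by removing the faces that contain `F₂` and inserting the faces of `B_{F,F₂}`. -/
def IsBistellarFlip (i j : ℕ) (M₁ M₂ : PreAbstractSimplicialComplex α) : Prop :=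
  ∃ F₁ F₂ : Finset α, F₁.Nonempty ∧ F₂.Nonempty ∧ Disjoint F₁ F₂ ∧ F₁.card = i ∧ F₂.card = j ∧
    M₁.induced (F₁ ∪ F₂) = flipBall (F₁ ∪ F₂) F₁ ∧
    M₂.faces = {s ∈ M₁.faces | ¬ F₂ ⊆ s} ∪ (flipBall (F₁ ∪ F₂) F₂).faces

/-- `ObtainedByFlips i j M k N`: the complex `N` is obtained from `M` by a sequence of exactly `k`
bistellar flips of type `(i, j)`. -/
inductive ObtainedByFlips (i j : ℕ) (M : PreAbstractSimplicialComplex α) :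
    ℕ → PreAbstractSimplicialComplex α → Prop
  | refl : ObtainedByFlips i j M 0 M
  | step {k : ℕ} {N N' : PreAbstractSimplicialComplex α} :
      ObtainedByFlips i j M k N → IsBistellarFlip i j N N' → ObtainedByFlips i j M (k + 1) N'

/-! ### Reduced simplicial homology and the `τ`-vector -/

variable (𝕜 : Type*) [Field 𝕜]

/-- The simplicial boundary operator on the vector space with basis all finite subsets of `α`:
a set `s = {v₀ < ⋯ < vₘ}` is sent to `∑ₗ (-1)ˡ (s \ {vₗ})`, and the empty set to `0`. -/
def boundary : (Finset α →₀ 𝕜) →ₗ[𝕜] (Finset α →₀ 𝕜) :=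
  Finsupp.linearCombination 𝕜 fun s : Finset α =>
    ∑ v ∈ s, Finsupp.single (s.erase v) ((-1 : 𝕜) ^ (s.filter (· < v)).card)

/-- The augmented `i`-chains of `K` (`i ≥ -1`): combinations of the `i`-dimensional faces, where
the empty face has dimension `-1`. -/
def chains (K : PreAbstractSimplicialComplex α) (i : ℤ) : Submodule 𝕜 (Finset α →₀ 𝕜) :=
  Finsupp.supported 𝕜 𝕜 {s ∈ K.augFaces | (s.card : ℤ) = i + 1}

/-- The reduced `i`-cycles of `K`. -/
def cycles (K : PreAbstractSimplicialComplex α) (i : ℤ) : Submodule 𝕜 (Finset α →₀ 𝕜) :=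
  K.chains 𝕜 i ⊓ LinearMap.ker (boundary 𝕜)

/-- The `i`-boundaries of `K`. -/
def boundaries (K : PreAbstractSimplicialComplex α) (i : ℤ) : Submodule 𝕜 (Finset α →₀ 𝕜) :=
  (K.chains 𝕜 (i + 1)).map (boundary 𝕜)

/-- The reduced Betti number `β̃ᵢ(K)` over `𝕜`: the dimension of the reduced homology group,
i.e. of the space of cycles modulo boundaries. -/
def reducedBetti (K : PreAbstractSimplicialComplex α) (i : ℤ) : ℕ :=
  Module.finrank 𝕜 ((K.cycles 𝕜 i).map (K.boundaries 𝕜 i).mkQ)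

/-- The entry `τᵢ(K)` of the `τ`-vector of `K`, regarded as a complex on the ground set `V`. -/
def tau (V : Finset α) (K : PreAbstractSimplicialComplex α) (i : ℤ) : ℚ :=
  1 / ((V.card : ℚ) + 1) *
    ∑ W ∈ V.powerset, ((K.induced W).reducedBetti 𝕜 i : ℚ) / (V.card.choose W.card : ℚ)

/-- A `d`-dimensional (pseudo-)manifold `K` is `𝕜`-orientable: its facets can be given signs `±1`
such that the sum of the signed facets is a cycle with coefficients in `𝕜`. In
characteristic two this always holds; otherwise it is orientability. -/
def IsOrientable (d : ℕ) (K : PreAbstractSimplicialComplex α) : Prop :=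
  ∃ z ∈ K.cycles 𝕜 (d : ℤ), ∀ s ∈ K.dFaces d, z s = 1 ∨ z s = -1

end LinearOrder

end PreAbstractSimplicialComplex

end

/-! `tau` is an average of the Betti numbers of the complexes `K.induced W`, in which every
cardinality of `W` has the same total weight. These weights are compatible with enlarging the ground
set (`Finset.levelAverage_insert`). Hence a complex K and the result K' of stacking the facet D with
apex v can be compared on one ground set, the vertices of K together with v, one subset W at a time.

If v ∉ W and D ⊄ W, then K'[W] = K[W]. If v ∈ W meets D, both K[W] and K'[W] have the homology of
K[W] with the cone over D attached (`reducedBetti_induced_of_not_disjoint`). If v ∈ W is disjoint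
from D, then K'[W] is K[W] plus an isolated vertex, so β̃₀ grows by one, except for W = {v}. If v ∉
W and D ⊆ W, then K[W] is K'[W] plus the face D, so removing D raises β̃ in degree d - 1 by one
unless D lies in the support of a d-cycle of K[W]. On a pseudomanifold a nonzero d-cycle involves
every facet, so with orientability this exception is exactly W = all vertices.

The two main events are exchanged by complementation and both have weight 1/((d+2)(d+3)). With m
vertices before the move, both exceptional sets have weight 1/((m+1)(m+2)) = 1/(m+1) - 1/(m+2),
which telescopes over the k moves. The induction carries `HasFullCycles`, which survives stacking,
together with the existence of a nonzero d-cycle where needed. -/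

noncomputable section

set_option linter.unusedSectionVars false

/-! ### Rank-nullity for submodules -/

namespace Submodule

variable {𝕜 E F : Type*} [Field 𝕜] [AddCommGroup E] [Module 𝕜 E] [AddCommGroup F] [Module 𝕜 F]

theorem finrank_map_add_finrank_inf_ker (f : E →ₗ[𝕜] F) (Z : Submodule 𝕜 E)
    [FiniteDimensional 𝕜 Z] :
    Module.finrank 𝕜 (Z.map f) + Module.finrank 𝕜 (Z ⊓ LinearMap.ker f : Submodule 𝕜 E) =
      Module.finrank 𝕜 Z := by
  have h := LinearMap.finrank_range_add_finrank_ker (f.domRestrict Z)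
  rw [LinearMap.range_domRestrict, LinearMap.ker_domRestrict] at h
  rw [← h, ← Submodule.finrank_map_subtype_eq Z (comap Z.subtype (LinearMap.ker f)),
    Submodule.map_comap_subtype]

/-- A functional that does not vanish on `Z` maps it onto the field. It is used with `f` the
coefficient at a newly added face. -/
theorem finrank_inf_ker_add_one (f : E →ₗ[𝕜] 𝕜) (Z : Submodule 𝕜 E) [FiniteDimensional 𝕜 Z]
    {x : E} (hx : x ∈ Z) (hfx : f x ≠ 0) :
    Module.finrank 𝕜 (Z ⊓ LinearMap.ker f : Submodule 𝕜 E) + 1 = Module.finrank 𝕜 Z := by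
  have h := finrank_map_add_finrank_inf_ker f Z
  have h1 : Z.map f = ⊤ := by
    rw [eq_top_iff]
    intro y _
    refine ⟨(y / f x) • x, Z.smul_mem _ hx, ?_⟩
    simp [hfx]
  rw [h1, finrank_top, Module.finrank_self] at h
  omega

end Submodule

/-! ### Boundary and cone operators, Betti numbers by dimension count -/

namespace PreAbstractSimplicialComplex

variable {α : Type*} [LinearOrder α] (𝕜 : Type*) [Field 𝕜]

/-- The incidence sign of `v` with respect to the ordered set `s`. -/
def incidenceSign (v : α) (s : Finset α) : 𝕜 := (-1 : 𝕜) ^ (s.filter (· < v)).card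

theorem incidenceSign_mul_self (v : α) (s : Finset α) :
    incidenceSign 𝕜 v s * incidenceSign 𝕜 v s = 1 := by
  rw [incidenceSign, ← pow_add, Even.neg_one_pow ⟨_, rfl⟩]

theorem incidenceSign_ne_zero (v : α) (s : Finset α) : incidenceSign 𝕜 v s ≠ 0 :=
  pow_ne_zero _ (neg_ne_zero.mpr one_ne_zero)

theorem incidenceSign_insert {v a : α} {s : Finset α} (ha : a ∉ s) :
    incidenceSign 𝕜 v (insert a s) =
      (if a < v then -1 else 1) * incidenceSign 𝕜 v s := by
  unfold incidenceSign
  rw [Finset.filter_insert]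
  split_ifs with h
  · rw [Finset.card_insert_of_notMem (by simp [ha]), pow_succ]
    ring
  · rw [one_mul]

theorem incidenceSign_erase (v a : α) (s : Finset α) (ha : a ∈ s) :
    incidenceSign 𝕜 v s = (if a < v then -1 else 1) * incidenceSign 𝕜 v (s.erase a) := by
  conv_lhs => rw [← Finset.insert_erase ha]
  exact incidenceSign_insert 𝕜 (Finset.notMem_erase a s)

/-- Exactly one of `a < v` and `v < a` holds, so exactly one of the two sides picks up an extra -1.
-/
theorem incidenceSign_swap {v a : α} {s : Finset α} (hv : v ∈ s) (ha : a ∉ s) :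
    incidenceSign 𝕜 a s * incidenceSign 𝕜 v (insert a s) =
      -(incidenceSign 𝕜 v s * incidenceSign 𝕜 a (s.erase v)) := by
  rw [incidenceSign_insert 𝕜 ha, incidenceSign_erase 𝕜 a v s hv]
  have hne : a ≠ v := fun h => ha (h ▸ hv)
  rcases lt_or_gt_of_ne hne with h | h
  · simp [h, h.not_gt]; ring
  · simp [h, h.not_gt]; ring

theorem boundary_single (s : Finset α) :
    boundary 𝕜 (Finsupp.single s 1) =
      ∑ v ∈ s, Finsupp.single (s.erase v) (incidenceSign 𝕜 v s) := by
  simp [boundary, incidenceSign]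

/-- The cone operator with apex `a`: it inserts `a`, with a sign, into the sets that do not
contain it, and kills the others. -/
def cone (a : α) : (Finset α →₀ 𝕜) →ₗ[𝕜] (Finset α →₀ 𝕜) :=
  Finsupp.linearCombination 𝕜 fun s : Finset α =>
    if a ∈ s then 0 else Finsupp.single (insert a s) (incidenceSign 𝕜 a s)

theorem cone_single_of_mem {a : α} {s : Finset α} (ha : a ∈ s) (c : 𝕜) :
    cone 𝕜 a (Finsupp.single s c) = 0 := by
  simp [cone, ha]

theorem cone_single_of_notMem {a : α} {s : Finset α} (ha : a ∉ s) (c : 𝕜) :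
    cone 𝕜 a (Finsupp.single s c) = Finsupp.single (insert a s) (c * incidenceSign 𝕜 a s) := by
  simp [cone, ha]

theorem boundary_cone_single (a : α) (s : Finset α) :
    boundary 𝕜 (cone 𝕜 a (Finsupp.single s 1)) + cone 𝕜 a (boundary 𝕜 (Finsupp.single s 1)) =
      Finsupp.single s 1 := by
  rw [boundary_single, map_sum]
  by_cases ha : a ∈ s
  · rw [cone_single_of_mem 𝕜 ha, map_zero, zero_add, Finset.sum_eq_single a]
    · rw [cone_single_of_notMem 𝕜 (Finset.notMem_erase a s), Finset.insert_erase ha,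
        incidenceSign_erase 𝕜 a a s ha]
      simp [incidenceSign_mul_self]
    · intro b hb hba
      exact cone_single_of_mem 𝕜 (Finset.mem_erase.mpr ⟨hba.symm, ha⟩) _
    · exact fun h => absurd ha h
  · rw [cone_single_of_notMem 𝕜 ha, one_mul, ← mul_one (incidenceSign 𝕜 a s),
      ← smul_eq_mul, ← Finsupp.smul_single, map_smul, boundary_single,
      Finset.sum_insert ha, Finset.erase_insert ha, smul_add, add_assoc, Finset.smul_sum,
      ← Finset.sum_add_distrib, Finset.sum_eq_zero, add_zero]
    · rw [Finsupp.smul_single, smul_eq_mul, incidenceSign_insert 𝕜 ha]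
      simp [incidenceSign_mul_self]
    · intro v hv
      have hne : a ≠ v := fun h => ha (h ▸ hv)
      rw [cone_single_of_notMem 𝕜 (fun h => ha (Finset.mem_of_mem_erase h)), Finsupp.smul_single,
        smul_eq_mul, incidenceSign_swap 𝕜 hv ha, Finset.erase_insert_of_ne hne,
        ← Finsupp.single_add, neg_add_cancel, Finsupp.single_zero]

/-- Coning is a contracting homotopy of the chain complex of all finite sets. Both ∂∂ = 0 and the
homological comparison of complexes rest on this formula. -/
theorem boundary_cone (a : α) (c : Finset α →₀ 𝕜) :
    boundary 𝕜 (cone 𝕜 a c) + cone 𝕜 a (boundary 𝕜 c) = c := by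
  have h : (boundary 𝕜).comp (cone 𝕜 a) + (cone 𝕜 a).comp (boundary 𝕜) =
      (LinearMap.id : (Finset α →₀ 𝕜) →ₗ[𝕜] _) := by
    refine Finsupp.lhom_ext' fun s => LinearMap.ext_ring ?_
    simpa using boundary_cone_single 𝕜 a s
  exact LinearMap.congr_fun h c

/-- By induction on the set: `insert a s` is up to sign the cone over `s`, and using the homotopy
formula twice turns ∂∂ of a cone into the cone of ∂∂. -/
theorem boundary_boundary (c : Finset α →₀ 𝕜) : boundary 𝕜 (boundary 𝕜 c) = 0 := by
  have key : ∀ s : Finset α, boundary 𝕜 (boundary 𝕜 (Finsupp.single s 1)) = 0 := by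
    intro s
    induction s using Finset.induction_on with
    | empty => simp [boundary_single]
    | insert a s ha ih =>
      have h1 : Finsupp.single (insert a s) (1 : 𝕜) =
          incidenceSign 𝕜 a s • cone 𝕜 a (Finsupp.single s 1) := by
        rw [cone_single_of_notMem 𝕜 ha, Finsupp.smul_single, smul_eq_mul, one_mul,
          incidenceSign_mul_self]
      rw [h1, map_smul, map_smul, eq_sub_of_add_eq (boundary_cone 𝕜 a (Finsupp.single s 1)),
        map_sub, eq_sub_of_add_eq (boundary_cone 𝕜 a (boundary 𝕜 (Finsupp.single s 1))), ih]
      simp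
  have h : (boundary 𝕜).comp (boundary 𝕜) = (0 : (Finset α →₀ 𝕜) →ₗ[𝕜] _) := by
    refine Finsupp.lhom_ext' fun s => LinearMap.ext_ring ?_
    simpa using key s
  exact LinearMap.congr_fun h c

variable {𝕜}

theorem exists_of_boundary_apply_ne_zero {c : Finset α →₀ 𝕜} {t : Finset α}
    (h : boundary 𝕜 c t ≠ 0) : ∃ s, c s ≠ 0 ∧ ∃ v ∈ s, s.erase v = t := by
  rw [boundary, Finsupp.linearCombination_apply, Finsupp.sum_apply] at h
  obtain ⟨s, hs, h⟩ := Finset.exists_ne_zero_of_sum_ne_zero h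
  refine ⟨s, by simpa using hs, ?_⟩
  simp only [Finsupp.smul_apply, Finsupp.finsetSum_apply] at h
  obtain ⟨v, hv, h⟩ := Finset.exists_ne_zero_of_sum_ne_zero (right_ne_zero_of_mul h)
  exact ⟨v, hv, by_contra fun hne => h (Finsupp.single_eq_of_ne (Ne.symm hne))⟩

theorem exists_of_cone_apply_ne_zero {a : α} {c : Finset α →₀ 𝕜} {t : Finset α}
    (h : cone 𝕜 a c t ≠ 0) : ∃ s, c s ≠ 0 ∧ a ∉ s ∧ insert a s = t := by
  rw [cone, Finsupp.linearCombination_apply, Finsupp.sum_apply] at h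
  obtain ⟨s, hs, h⟩ := Finset.exists_ne_zero_of_sum_ne_zero h
  refine ⟨s, by simpa using hs, ?_⟩
  simp only [Finsupp.smul_apply] at h
  have h := right_ne_zero_of_mul h
  split_ifs at h with ha
  · simp at h
  · exact ⟨ha, by_contra fun hne => h (Finsupp.single_eq_of_ne (Ne.symm hne))⟩

theorem mem_chains {K : PreAbstractSimplicialComplex α} {i : ℤ} {c : Finset α →₀ 𝕜} :
    c ∈ K.chains 𝕜 i ↔ ∀ s, c s ≠ 0 → s ∈ K.augFaces ∧ (s.card : ℤ) = i + 1 := by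
  rw [chains, Finsupp.mem_supported']
  exact forall_congr' fun s => by rw [← not_imp_not, not_not]; rfl

theorem mem_augFaces_of_subset {K : PreAbstractSimplicialComplex α} {s t : Finset α}
    (hs : s ∈ K.augFaces) (h : t ⊆ s) : t ∈ K.augFaces := by
  rcases t.eq_empty_or_nonempty with rfl | ht
  · exact Set.mem_insert _ _
  · rcases hs with rfl | hs
    · exact absurd (Finset.subset_empty.mp h) ht.ne_empty
    · exact Set.mem_insert_of_mem _ ((K.isRelLowerSet_faces hs).2 h ht)

theorem boundary_mem_chains {K : PreAbstractSimplicialComplex α} {i : ℤ} {c : Finset α →₀ 𝕜}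
    (hc : c ∈ K.chains 𝕜 (i + 1)) : boundary 𝕜 c ∈ K.chains 𝕜 i := by
  rw [mem_chains] at hc ⊢
  intro t ht
  obtain ⟨s, hs, v, hv, rfl⟩ := exists_of_boundary_apply_ne_zero ht
  obtain ⟨h1, h2⟩ := hc s hs
  refine ⟨mem_augFaces_of_subset h1 (Finset.erase_subset _ _), ?_⟩
  have := Finset.card_erase_add_one hv
  omega

theorem chains_mono {K L : PreAbstractSimplicialComplex α} (h : L.augFaces ⊆ K.augFaces) (i : ℤ) :
    L.chains 𝕜 i ≤ K.chains 𝕜 i := fun _ hc =>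
  mem_chains.mpr fun s hs => ⟨h (mem_chains.mp hc s hs).1, (mem_chains.mp hc s hs).2⟩

theorem boundaries_le_cycles (K : PreAbstractSimplicialComplex α) (i : ℤ) :
    K.boundaries 𝕜 i ≤ K.cycles 𝕜 i := by
  rintro _ ⟨c, hc, rfl⟩
  exact ⟨boundary_mem_chains hc, boundary_boundary 𝕜 c⟩

theorem finiteDimensional_chains {K : PreAbstractSimplicialComplex α} (hK : K.faces.Finite)
    (i : ℤ) : FiniteDimensional 𝕜 (K.chains 𝕜 i) := by
  have hfin : {s ∈ K.augFaces | (s.card : ℤ) = i + 1}.Finite :=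
    (hK.insert ∅).subset fun _ h => h.1
  have := hfin.to_subtype
  exact Module.Finite.equiv
    (Finsupp.supportedEquivFinsupp (R := 𝕜) (M := 𝕜) {s ∈ K.augFaces | (s.card : ℤ) = i + 1}).symm

theorem finiteDimensional_cycles {K : PreAbstractSimplicialComplex α} (hK : K.faces.Finite)
    (i : ℤ) : FiniteDimensional 𝕜 (K.cycles 𝕜 i) :=
  have := finiteDimensional_chains (𝕜 := 𝕜) hK i
  Submodule.finiteDimensional_of_le inf_le_left

theorem reducedBetti_add_finrank_boundaries {K : PreAbstractSimplicialComplex α}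
    (hK : K.faces.Finite) (i : ℤ) :
    K.reducedBetti 𝕜 i + Module.finrank 𝕜 (K.boundaries 𝕜 i) =
      Module.finrank 𝕜 (K.cycles 𝕜 i) := by
  have := finiteDimensional_cycles (𝕜 := 𝕜) hK i
  have h := Submodule.finrank_map_add_finrank_inf_ker (K.boundaries 𝕜 i).mkQ (K.cycles 𝕜 i)
  rwa [Submodule.ker_mkQ, inf_eq_right.mpr (boundaries_le_cycles K i)] at h

theorem finrank_boundaries_add_finrank_cycles {K : PreAbstractSimplicialComplex α}
    (hK : K.faces.Finite) (i : ℤ) :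
    Module.finrank 𝕜 (K.boundaries 𝕜 i) + Module.finrank 𝕜 (K.cycles 𝕜 (i + 1)) =
      Module.finrank 𝕜 (K.chains 𝕜 (i + 1)) :=
  have := finiteDimensional_chains (𝕜 := 𝕜) hK (i + 1)
  Submodule.finrank_map_add_finrank_inf_ker (boundary 𝕜) (K.chains 𝕜 (i + 1))

end PreAbstractSimplicialComplex

/-! ### Comparing homology: matched faces and single added faces -/

namespace PreAbstractSimplicialComplex
variable {α : Type*} [LinearOrder α] {𝕜 : Type*} [Field 𝕜]

theorem cycles_mono {K L : PreAbstractSimplicialComplex α} (h : L.augFaces ⊆ K.augFaces) (i : ℤ) :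
    L.cycles 𝕜 i ≤ K.cycles 𝕜 i :=
  inf_le_inf_right _ (chains_mono h i)

theorem boundary_apply_eq_zero {K : PreAbstractSimplicialComplex α} {c : Finset α →₀ 𝕜}
    (hc : ∀ s, c s ≠ 0 → s ∈ K.augFaces) {t : Finset α} (ht : t ∉ K.augFaces) :
    boundary 𝕜 c t = 0 := by
  by_contra h
  obtain ⟨s, hs, v, -, rfl⟩ := exists_of_boundary_apply_ne_zero h
  exact ht (mem_augFaces_of_subset (hc s hs) (Finset.erase_subset _ _))

/-- If the faces of `K` outside `L` come in pairs that differ by the element `a`, then every chain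
of `K` with boundary in `L` is homologous to a chain of `L`. -/
theorem exists_sub_boundary_mem_chains {K L : PreAbstractSimplicialComplex α} (a : α)
    (hins : ∀ s ∈ K.augFaces, s ∉ L.augFaces → insert a s ∈ K.augFaces)
    (her : ∀ s ∈ K.augFaces, s ∉ L.augFaces → s.erase a ∉ L.augFaces)
    {i : ℤ} {y : Finset α →₀ 𝕜} (hy : y ∈ K.chains 𝕜 i)
    (hb : ∀ t, boundary 𝕜 y t ≠ 0 → t ∈ L.augFaces) :
    ∃ w ∈ K.chains 𝕜 (i + 1), (∀ s, w s ≠ 0 → s ∉ L.augFaces) ∧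
      y - boundary 𝕜 w ∈ L.chains 𝕜 i := by
  classical
  -- `p` is the part of `y` outside `L`, and w is its cone. The homotopy formula gives y - ∂w = (y -
  -- p) + cone(∂p).
  obtain ⟨p, hpos, hneg⟩ : ∃ p : Finset α →₀ 𝕜,
      (∀ s, s ∉ L.augFaces → p s = y s) ∧ ∀ s, s ∈ L.augFaces → p s = 0 :=
    ⟨y.filter (· ∉ L.augFaces), fun s hs => Finsupp.filter_apply_pos _ _ hs,
      fun s hs => Finsupp.filter_apply_neg _ _ (not_not.mpr hs)⟩
  have hpy : ∀ s, p s ≠ 0 → y s ≠ 0 ∧ s ∉ L.augFaces := by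
    intro s hs
    by_cases h : s ∈ L.augFaces
    · exact absurd (hneg s h) hs
    · exact ⟨hpos s h ▸ hs, h⟩
  have hw : cone 𝕜 a p ∈ K.chains 𝕜 (i + 1) := by
    refine mem_chains.mpr fun t ht => ?_
    obtain ⟨s, hs, ha, rfl⟩ := exists_of_cone_apply_ne_zero ht
    obtain ⟨h1, h2⟩ := mem_chains.mp hy s (hpy s hs).1
    refine ⟨hins s h1 (hpy s hs).2, ?_⟩
    rw [Finset.card_insert_of_notMem ha]
    push_cast
    omega
  refine ⟨cone 𝕜 a p, hw, ?_, ?_⟩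
  · intro t ht
    obtain ⟨s, hs, ha, rfl⟩ := exists_of_cone_apply_ne_zero ht
    exact fun h => (hpy s hs).2 (mem_augFaces_of_subset h (Finset.subset_insert _ _))
  · refine mem_chains.mpr fun t ht => ?_
    obtain ⟨htK, hcard⟩ := mem_chains.mp (Submodule.sub_mem _ hy (boundary_mem_chains hw)) t ht
    refine ⟨by_contra fun htL => ?_, hcard⟩
    -- Off `L` only cone(∂p) remains, so `t = insert a s` with ∂p nonzero at `s`. As `s` is outside
    -- `L` and y - p lives on `L`, ∂y is nonzero at `s` too, against `hb`.
    rw [Finsupp.sub_apply, ← hpos _ htL,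
      ← Finsupp.sub_apply, ← eq_sub_of_add_eq' (boundary_cone 𝕜 a p)] at ht
    obtain ⟨s, hs, ha, rfl⟩ := exists_of_cone_apply_ne_zero ht
    have hsL : s ∉ L.augFaces := by simpa [ha] using her _ htK htL
    have h1 : boundary 𝕜 (y - p) s = 0 := by
      refine boundary_apply_eq_zero (K := L) (fun r hr => by_contra fun h => hr ?_) hsL
      rw [Finsupp.sub_apply, hpos r h, sub_self]
    rw [map_sub, Finsupp.sub_apply, sub_eq_zero] at h1
    exact hsL (hb s (h1 ▸ hs))

/-- Pushing chains into `L` shows that Z(L) + B(K) = Z(K) and Z(L) ∩ B(K) = B(L), so the inclusion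
induces an isomorphism in homology. The conclusion follows from the dimension formula for sums and
intersections. -/
theorem reducedBetti_eq_of_toggle {K L : PreAbstractSimplicialComplex α} (hK : K.faces.Finite)
    (hLK : L.augFaces ⊆ K.augFaces) (a : α)
    (hins : ∀ s ∈ K.augFaces, s ∉ L.augFaces → insert a s ∈ K.augFaces)
    (her : ∀ s ∈ K.augFaces, s ∉ L.augFaces → s.erase a ∉ L.augFaces) (i : ℤ) :
    K.reducedBetti 𝕜 i = L.reducedBetti 𝕜 i := by
  have hL : L.faces.Finite := by
    refine hK.subset fun s hs => ?_
    rcases hLK (Set.mem_insert_of_mem _ hs) with rfl | h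
    · exact absurd (L.isRelLowerSet_faces hs).1 Finset.not_nonempty_empty
    · exact h
  have hsup : L.cycles 𝕜 i ⊔ K.boundaries 𝕜 i = K.cycles 𝕜 i := by
    refine le_antisymm (sup_le (cycles_mono hLK i) (boundaries_le_cycles K i)) fun z hz => ?_
    obtain ⟨w, hw, -, hzw⟩ := exists_sub_boundary_mem_chains a hins her hz.1
      (by rw [LinearMap.mem_ker.mp hz.2]; simp)
    rw [← sub_add_cancel z (boundary 𝕜 w)]
    refine Submodule.add_mem_sup ⟨hzw, ?_⟩ (Submodule.mem_map_of_mem hw)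
    rw [SetLike.mem_coe, LinearMap.mem_ker, map_sub, LinearMap.mem_ker.mp hz.2, boundary_boundary,
      sub_zero]
  have hinf : L.cycles 𝕜 i ⊓ K.boundaries 𝕜 i = L.boundaries 𝕜 i := by
    refine le_antisymm ?_ (le_inf (boundaries_le_cycles L i)
      (Submodule.map_mono (chains_mono hLK _)))
    rintro _ ⟨hz, y, hy, rfl⟩
    obtain ⟨w, -, -, hyw⟩ := exists_sub_boundary_mem_chains a hins her hy
      (fun t ht => (mem_chains.mp hz.1 t ht).1)
    refine ⟨_, hyw, ?_⟩
    rw [map_sub, boundary_boundary, sub_zero]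
  have := finiteDimensional_cycles (𝕜 := 𝕜) hL i
  have := finiteDimensional_cycles (𝕜 := 𝕜) hK i
  have : FiniteDimensional 𝕜 (K.boundaries 𝕜 i) :=
    Submodule.finiteDimensional_of_le (boundaries_le_cycles K i)
  have h := Submodule.finrank_sup_add_finrank_inf_eq (L.cycles 𝕜 i) (K.boundaries 𝕜 i)
  rw [hsup, hinf] at h
  have h1 := reducedBetti_add_finrank_boundaries (𝕜 := 𝕜) hK i
  have h2 := reducedBetti_add_finrank_boundaries (𝕜 := 𝕜) hL i
  omega

section AddFace

variable {K L : PreAbstractSimplicialComplex α} {s : Finset α} {m : ℤ}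

theorem chains_eq_of_augFaces_eq_insert (haug : K.augFaces = insert s L.augFaces)
    (hm : (s.card : ℤ) = m + 1) {i : ℤ} (hi : i ≠ m) : K.chains 𝕜 i = L.chains 𝕜 i := by
  ext c
  rw [mem_chains, mem_chains, haug]
  refine forall_congr' fun t => imp_congr_right fun _ => and_congr_left fun ht => ?_
  rw [Set.mem_insert_iff, or_iff_right]
  rintro rfl
  omega

theorem chains_inf_ker_of_augFaces_eq_insert (haug : K.augFaces = insert s L.augFaces)
    (hs : s ∉ L.augFaces) (i : ℤ) :
    K.chains 𝕜 i ⊓ LinearMap.ker (Finsupp.lapply s) = L.chains 𝕜 i := by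
  ext c
  rw [Submodule.mem_inf, mem_chains, mem_chains, haug, LinearMap.mem_ker, Finsupp.lapply_apply]
  constructor
  · rintro ⟨h, h0⟩ t ht
    refine ⟨(h t ht).1.resolve_left ?_, (h t ht).2⟩
    rintro rfl
    exact ht h0
  · exact fun h => ⟨fun t ht => ⟨Set.mem_insert_of_mem _ (h t ht).1, (h t ht).2⟩,
      by_contra fun h0 => hs (h s h0).1⟩

theorem cycles_inf_ker_of_augFaces_eq_insert (haug : K.augFaces = insert s L.augFaces)
    (hs : s ∉ L.augFaces) (i : ℤ) :
    K.cycles 𝕜 i ⊓ LinearMap.ker (Finsupp.lapply s) = L.cycles 𝕜 i := by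
  rw [cycles, cycles, inf_right_comm, chains_inf_ker_of_augFaces_eq_insert haug hs]

theorem finrank_chains_of_augFaces_eq_insert (hK : K.faces.Finite)
    (haug : K.augFaces = insert s L.augFaces) (hs : s ∉ L.augFaces)
    (hm : (s.card : ℤ) = m + 1) :
    Module.finrank 𝕜 (K.chains 𝕜 m) = Module.finrank 𝕜 (L.chains 𝕜 m) + 1 := by
  have := finiteDimensional_chains (𝕜 := 𝕜) hK m
  rw [← chains_inf_ker_of_augFaces_eq_insert haug hs]
  refine (Submodule.finrank_inf_ker_add_one _ _ (x := Finsupp.single s 1) ?_ ?_).symm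
  · exact Finsupp.single_mem_supported 𝕜 _ ⟨haug ▸ Set.mem_insert _ _, hm⟩
  · simp

theorem reducedBetti_of_augFaces_eq_insert (haug : K.augFaces = insert s L.augFaces)
    (hm : (s.card : ℤ) = m + 1) {i : ℤ} (hi : i ≠ m) (hi' : i + 1 ≠ m) :
    K.reducedBetti 𝕜 i = L.reducedBetti 𝕜 i := by
  rw [reducedBetti, reducedBetti, cycles, cycles, boundaries, boundaries,
    chains_eq_of_augFaces_eq_insert haug hm hi, chains_eq_of_augFaces_eq_insert haug hm hi']

theorem finite_faces_of_augFaces_eq_insert (hK : K.faces.Finite)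
    (haug : K.augFaces = insert s L.augFaces) : L.faces.Finite :=
  Set.Finite.subset (hK.insert ∅) fun _ ht =>
    haug.superset (Set.mem_insert_of_mem _ (Set.mem_insert_of_mem _ ht))

/-- Adding an `m`-face that lies in the support of an `m`-cycle creates homology in degree `m`. -/
theorem reducedBetti_of_mem_cycles (hK : K.faces.Finite)
    (haug : K.augFaces = insert s L.augFaces) (hs : s ∉ L.augFaces) (hm : (s.card : ℤ) = m + 1)
    {z : Finset α →₀ 𝕜} (hz : z ∈ K.cycles 𝕜 m) (hzs : z s ≠ 0) :
    K.reducedBetti 𝕜 m = L.reducedBetti 𝕜 m + 1 ∧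
      ∀ i, i + 1 = m → K.reducedBetti 𝕜 i = L.reducedBetti 𝕜 i := by
  have hL := finite_faces_of_augFaces_eq_insert hK haug
  have := finiteDimensional_cycles (𝕜 := 𝕜) hK m
  have h1 := Submodule.finrank_inf_ker_add_one (Finsupp.lapply s) (K.cycles 𝕜 m) hz hzs
  rw [cycles_inf_ker_of_augFaces_eq_insert haug hs] at h1
  constructor
  · have h2 := reducedBetti_add_finrank_boundaries (𝕜 := 𝕜) hK m
    have h3 := reducedBetti_add_finrank_boundaries (𝕜 := 𝕜) hL m
    rw [boundaries, chains_eq_of_augFaces_eq_insert haug hm (by omega), ← boundaries] at h2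
    omega
  · rintro i rfl
    -- Chains and cycles in degree m both gain one dimension, so the boundaries one degree lower do
    -- not change in dimension.
    have h2 := reducedBetti_add_finrank_boundaries (𝕜 := 𝕜) hK i
    have h3 := reducedBetti_add_finrank_boundaries (𝕜 := 𝕜) hL i
    have h4 := finrank_boundaries_add_finrank_cycles (𝕜 := 𝕜) hK i
    have h5 := finrank_boundaries_add_finrank_cycles (𝕜 := 𝕜) hL i
    have h6 := finrank_chains_of_augFaces_eq_insert (𝕜 := 𝕜) hK haug hs hm
    have h7 : K.cycles 𝕜 i = L.cycles 𝕜 i := by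
      rw [cycles, cycles, chains_eq_of_augFaces_eq_insert haug hm (by omega)]
    rw [h7] at h2
    omega

/-- Adding an `m`-face that lies in the support of no `m`-cycle kills homology in degree
`m - 1`. -/
theorem reducedBetti_of_forall_cycles (hK : K.faces.Finite)
    (haug : K.augFaces = insert s L.augFaces) (hs : s ∉ L.augFaces) (hm : (s.card : ℤ) = m + 1)
    (hz : ∀ z ∈ K.cycles 𝕜 m, z s = 0) :
    K.reducedBetti 𝕜 m = L.reducedBetti 𝕜 m ∧
      ∀ i, i + 1 = m → K.reducedBetti 𝕜 i + 1 = L.reducedBetti 𝕜 i := by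
  have hL := finite_faces_of_augFaces_eq_insert hK haug
  have h1 : K.cycles 𝕜 m = L.cycles 𝕜 m := by
    rw [← cycles_inf_ker_of_augFaces_eq_insert haug hs]
    exact (inf_eq_left.mpr hz).symm
  constructor
  · rw [reducedBetti, reducedBetti, h1, boundaries, boundaries,
      chains_eq_of_augFaces_eq_insert haug hm (by omega)]
  · rintro i rfl
    -- Here the chains gain a dimension but the cycles do not, so the boundaries one degree lower
    -- gain it.
    have h2 := reducedBetti_add_finrank_boundaries (𝕜 := 𝕜) hK i
    have h3 := reducedBetti_add_finrank_boundaries (𝕜 := 𝕜) hL i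
    have h4 := finrank_boundaries_add_finrank_cycles (𝕜 := 𝕜) hK i
    have h5 := finrank_boundaries_add_finrank_cycles (𝕜 := 𝕜) hL i
    have h6 := finrank_chains_of_augFaces_eq_insert (𝕜 := 𝕜) hK haug hs hm
    have h7 : K.cycles 𝕜 i = L.cycles 𝕜 i := by
      rw [cycles, cycles, chains_eq_of_augFaces_eq_insert haug hm (by omega)]
    rw [h7] at h2
    rw [h1] at h4
    omega

end AddFace

end PreAbstractSimplicialComplex

/-- The weighted average of a set function over all subsets of `V` which occurs in `tau`: all
cardinalities of the subsets have the same total weight. -/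
def Finset.levelAverage {α : Type*} (V : Finset α) (f : Finset α → ℚ) : ℚ :=
  1 / ((V.card : ℚ) + 1) * ∑ W ∈ V.powerset, f W / (V.card.choose W.card : ℚ)

/-! ### Weighted averages over subsets -/

namespace Finset

variable {α : Type*} {V : Finset α}

theorem levelAverage_congr {f g : Finset α → ℚ} (h : ∀ W ⊆ V, f W = g W) :
    V.levelAverage f = V.levelAverage g := by
  unfold levelAverage
  congr 1
  exact sum_congr rfl fun W hW => by rw [h W (mem_powerset.mp hW)]

theorem levelAverage_add (f g : Finset α → ℚ) :
    V.levelAverage (fun W => f W + g W) = V.levelAverage f + V.levelAverage g := by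
  simp only [levelAverage, add_div, sum_add_distrib, mul_add]

theorem levelAverage_sub (f g : Finset α → ℚ) :
    V.levelAverage (fun W => f W - g W) = V.levelAverage f - V.levelAverage g := by
  simp only [levelAverage, sub_div, sum_sub_distrib, mul_sub]

variable [DecidableEq α]

theorem levelAverage_ite_eq {U : Finset α} (hU : U ⊆ V) :
    V.levelAverage (fun W => if W = U then 1 else 0) =
      1 / (((V.card : ℚ) + 1) * (V.card.choose U.card : ℚ)) := by
  rw [levelAverage, sum_eq_single U]
  · simp [mul_comm]
  · intro W _ hW
    simp [hW]
  · exact fun h => absurd (mem_powerset.mpr hU) h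

/-- The weights are invariant under complementation by the symmetry of binomial coefficients. -/
theorem levelAverage_compl (f : Finset α → ℚ) :
    V.levelAverage (fun W => f (V \ W)) = V.levelAverage f := by
  unfold levelAverage
  congr 1
  refine sum_nbij' (V \ ·) (V \ ·) ?_ ?_ ?_ ?_ ?_
  · exact fun W _ => mem_powerset.mpr sdiff_subset
  · exact fun W _ => mem_powerset.mpr sdiff_subset
  · exact fun W hW => sdiff_sdiff_eq_self (mem_powerset.mp hW)
  · exact fun W hW => sdiff_sdiff_eq_self (mem_powerset.mp hW)
  · intro W hW
    rw [card_sdiff_of_subset (mem_powerset.mp hW),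
      Nat.choose_symm (card_le_card (mem_powerset.mp hW))]

/-- After normalization, the weights of `W` and `insert x W` in the larger ground set add up to the
weight of `W` in the smaller one. -/
theorem _root_.Nat.inv_choose_add_inv_choose_succ {n k : ℕ} (h : k ≤ n) :
    1 / ((n + 1).choose k : ℚ) + 1 / ((n + 1).choose (k + 1) : ℚ) =
      ((n : ℚ) + 2) / (((n : ℚ) + 1) * (n.choose k : ℚ)) := by
  have h0 : (n.choose k : ℚ) ≠ 0 := by exact_mod_cast (Nat.choose_pos h).ne'
  have h1 : ((n + 1).choose k : ℚ) ≠ 0 := by exact_mod_cast (Nat.choose_pos (by omega)).ne'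
  have h2 : ((n + 1).choose (k + 1) : ℚ) ≠ 0 := by
    exact_mod_cast (Nat.choose_pos (by omega)).ne'
  have e1 : ((n : ℚ) + 1) * (n.choose k : ℚ) = ((n + 1).choose (k + 1) : ℚ) * ((k : ℚ) + 1) := by
    exact_mod_cast Nat.add_one_mul_choose_eq n k
  have e2 : ((n : ℚ) + 1) * (n.choose k : ℚ) = ((n + 1).choose k : ℚ) * ((n : ℚ) + 1 - k) := by
    have := Nat.choose_mul_succ_eq n k
    have h3 : ((n + 1 - k : ℕ) : ℚ) = (n : ℚ) + 1 - k := by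
      rw [Nat.cast_sub (by omega)]; push_cast; ring
    rw [← h3, mul_comm]
    exact_mod_cast this
  have hn : (n : ℚ) + 1 ≠ 0 := by positivity
  have i1 : 1 / ((n + 1).choose (k + 1) : ℚ) = ((k : ℚ) + 1) / (((n : ℚ) + 1) * n.choose k) := by
    rw [div_eq_div_iff h2 (mul_ne_zero hn h0)]
    linear_combination e1
  have i2 : 1 / ((n + 1).choose k : ℚ) = ((n : ℚ) + 1 - k) / (((n : ℚ) + 1) * n.choose k) := by
    rw [div_eq_div_iff h1 (mul_ne_zero hn h0)]
    linear_combination e2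
  rw [i1, i2, ← add_div]
  congr 1
  ring

theorem levelAverage_insert {x : α} (hx : x ∉ V) {f : Finset α → ℚ}
    (hf : ∀ W ⊆ V, f (insert x W) = f W) :
    (insert x V).levelAverage f = V.levelAverage f := by
  unfold levelAverage
  rw [sum_powerset_insert hx, card_insert_of_notMem hx, ← sum_add_distrib, mul_sum, mul_sum]
  refine sum_congr rfl fun W hW => ?_
  have hW := mem_powerset.mp hW
  rw [hf W hW, card_insert_of_notMem fun h => hx (hW h)]
  have h := Nat.inv_choose_add_inv_choose_succ (card_le_card hW)
  have h0 : (V.card.choose W.card : ℚ) ≠ 0 := by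
    exact_mod_cast (Nat.choose_pos (card_le_card hW)).ne'
  rw [div_eq_mul_one_div (f W) (((V.card + 1).choose W.card : ℕ) : ℚ),
    div_eq_mul_one_div (f W) (((V.card + 1).choose (W.card + 1) : ℕ) : ℚ), ← mul_add, h]
  push_cast
  field_simp
  ring

theorem levelAverage_eq_of_subset {U : Finset α} (hU : U ⊆ V) {f : Finset α → ℚ}
    (hf : ∀ x ∉ U, ∀ W, f (insert x W) = f W) : V.levelAverage f = U.levelAverage f := by
  have key : ∀ T : Finset α, Disjoint U T → (U ∪ T).levelAverage f = U.levelAverage f := by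
    intro T
    induction T using Finset.induction_on with
    | empty => simp
    | insert x T hx ih =>
      intro hd
      rw [disjoint_insert_right] at hd
      rw [union_insert, levelAverage_insert (by simp [hd.1, hx]) fun W _ => hf x hd.1 W, ih hd.2]
  rw [← union_sdiff_of_subset hU]
  exact key _ disjoint_sdiff

/-- Whether `D ⊆ W` depends only on W ∩ D, so the ground set may be shrunk to `D`. There `D` is the
only such subset and fills one of |D| + 1 levels. -/
theorem levelAverage_superset {D : Finset α} (hD : D ⊆ V) :
    V.levelAverage (fun W => if D ⊆ W then 1 else 0) = 1 / ((D.card : ℚ) + 1) := by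
  rw [levelAverage_eq_of_subset hD]
  · rw [levelAverage_congr (g := fun W => if W = D then 1 else 0), levelAverage_ite_eq subset_rfl]
    · simp
    · intro W hW
      by_cases h : W = D
      · simp [h]
      · rw [if_neg h, if_neg fun h' => h (Subset.antisymm hW h')]
  · intro x hx W
    simp only [subset_insert_iff_of_notMem hx]

theorem levelAverage_superset_notMem {D : Finset α} {v : α} (hv : v ∉ D) (hD : insert v D ⊆ V) :
    V.levelAverage (fun W => if v ∉ W ∧ D ⊆ W then 1 else 0) =
      1 / (((D.card : ℚ) + 1) * ((D.card : ℚ) + 2)) := by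
  have h : V.levelAverage (fun W => if v ∉ W ∧ D ⊆ W then 1 else 0) =
      V.levelAverage (fun W => (if D ⊆ W then 1 else 0) - (if insert v D ⊆ W then 1 else 0)) := by
    refine levelAverage_congr fun W _ => ?_
    by_cases h1 : v ∈ W <;> by_cases h2 : D ⊆ W <;> simp [insert_subset_iff, h1, h2]
  rw [h, levelAverage_sub, levelAverage_superset ((subset_insert v D).trans hD),
    levelAverage_superset hD, card_insert_of_notMem hv]
  push_cast
  field_simp
  ring

/-- Complementation turns this event into `v ∉ W ∧ D ⊆ W`. This is why degrees 0 and d - 1 receive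
the same correction. -/
theorem levelAverage_disjoint_mem {D : Finset α} {v : α} (hv : v ∉ D) (hD : insert v D ⊆ V) :
    V.levelAverage (fun W => if v ∈ W ∧ Disjoint D W then 1 else 0) =
      1 / (((D.card : ℚ) + 1) * ((D.card : ℚ) + 2)) := by
  rw [← levelAverage_superset_notMem hv hD, ← levelAverage_compl]
  refine levelAverage_congr fun W _ => ?_
  rw [insert_subset_iff] at hD
  have h : Disjoint D (V \ W) ↔ D ⊆ W := by
    rw [disjoint_left]
    exact forall₂_congr fun x hx => by simp [hD.2 hx]
  simp only [mem_sdiff, hD.1, true_and, h]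

end Finset

/-! ### Induced subcomplexes, ground sets, and top cycles of pseudomanifolds -/

namespace PreAbstractSimplicialComplex
variable {α : Type*} [LinearOrder α] {𝕜 : Type*} [Field 𝕜]

theorem mem_faces_iff {K : PreAbstractSimplicialComplex α} {s : Finset α} :
    s ∈ K.faces ↔ s ∈ K.augFaces ∧ s.Nonempty := by
  refine ⟨fun h => ⟨Set.mem_insert_of_mem _ h, (K.isRelLowerSet_faces h).1⟩, ?_⟩
  rintro ⟨rfl | h, hs⟩
  · exact absurd hs Finset.not_nonempty_empty
  · exact h

theorem empty_mem_augFaces (K : PreAbstractSimplicialComplex α) : ∅ ∈ K.augFaces :=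
  Set.mem_insert _ _

theorem ext_augFaces {K L : PreAbstractSimplicialComplex α}
    (h : ∀ s, s ∈ K.augFaces ↔ s ∈ L.augFaces) : K = L := by
  refine SetLike.coe_injective (Set.ext fun s => ?_)
  change s ∈ K.faces ↔ s ∈ L.faces
  rw [mem_faces_iff, mem_faces_iff, h]

theorem mem_augFaces_induced {K : PreAbstractSimplicialComplex α} {W s : Finset α} :
    s ∈ (K.induced W).augFaces ↔ s ∈ K.augFaces ∧ s ⊆ W := by
  simp only [augFaces, Set.mem_insert_iff, induced, Set.mem_ofPred_eq]
  constructor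
  · rintro (rfl | h)
    · simp
    · exact ⟨Or.inr h.1, h.2⟩
  · rintro ⟨rfl | h, h'⟩
    · exact Or.inl rfl
    · exact Or.inr ⟨h, h'⟩

theorem finite_faces_induced (K : PreAbstractSimplicialComplex α) (W : Finset α) :
    (K.induced W).faces.Finite :=
  (W.powerset.finite_toSet).subset fun _ hs => Finset.mem_coe.mpr (Finset.mem_powerset.mpr hs.2)

theorem mem_vertexSet_iff {K : PreAbstractSimplicialComplex α} {x : α} :
    x ∈ K.vertexSet ↔ {x} ∈ K.augFaces := by
  rw [vertexSet, Set.mem_ofPred_eq, mem_faces_iff, and_iff_left (Finset.singleton_nonempty x)]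

theorem mem_vertexSet_of_mem {K : PreAbstractSimplicialComplex α} {s : Finset α} {x : α}
    (hs : s ∈ K.augFaces) (hx : x ∈ s) : x ∈ K.vertexSet :=
  mem_vertexSet_iff.mpr (mem_augFaces_of_subset hs (Finset.singleton_subset_iff.mpr hx))

theorem finite_vertexSet {K : PreAbstractSimplicialComplex α} (hK : K.faces.Finite) :
    K.vertexSet.Finite :=
  hK.preimage (Finset.singleton_injective.injOn)

theorem induced_insert_of_notMem {K : PreAbstractSimplicialComplex α} {x : α}
    (hx : x ∉ K.vertexSet) (W : Finset α) : K.induced (insert x W) = K.induced W := by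
  refine ext_augFaces fun s => ?_
  rw [mem_augFaces_induced, mem_augFaces_induced]
  refine and_congr_right fun hs => ?_
  rw [Finset.subset_insert_iff_of_notMem fun h => hx (mem_vertexSet_of_mem hs h)]

theorem tau_eq_levelAverage (V : Finset α) (K : PreAbstractSimplicialComplex α) (i : ℤ) :
    K.tau 𝕜 V i = V.levelAverage fun W => ((K.induced W).reducedBetti 𝕜 i : ℚ) :=
  rfl

/-- The `τ`-vector does not depend on the ground set. -/
theorem tau_eq_of_subset {K : PreAbstractSimplicialComplex α} {U V : Finset α}
    (hU : K.vertexSet ⊆ U) (hV : U ⊆ V) (i : ℤ) : K.tau 𝕜 V i = K.tau 𝕜 U i := by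
  rw [tau_eq_levelAverage, tau_eq_levelAverage]
  refine Finset.levelAverage_eq_of_subset hV fun x hx W => ?_
  rw [induced_insert_of_notMem fun h => hx (Finset.mem_coe.mp (hU h))]

theorem boundary_single_apply_erase {s : Finset α} {x : α} (hx : x ∈ s) :
    boundary 𝕜 (Finsupp.single s 1) (s.erase x) = incidenceSign 𝕜 x s := by
  rw [boundary_single, Finsupp.finsetSum_apply, Finset.sum_eq_single x]
  · exact Finsupp.single_eq_same
  · intro y hy hyx
    exact Finsupp.single_eq_of_ne fun h => hyx (Finset.erase_injOn s hy hx h.symm)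
  · exact fun h => absurd hx h

theorem exists_of_boundary_single_apply_ne_zero {s t : Finset α}
    (h : boundary 𝕜 (Finsupp.single s 1) t ≠ 0) : ∃ x ∈ s, s.erase x = t := by
  obtain ⟨r, hr, h⟩ := exists_of_boundary_apply_ne_zero h
  have : r = s := by_contra fun hne => hr (Finsupp.single_eq_of_ne hne)
  exact this ▸ h

/-- The properties of a `d`-dimensional pseudo-manifold that determine the effect of stacking moves
on Betti numbers of induced subcomplexes: a nonzero `d`-cycle involves all facets, and the
facets cover all vertices. -/
structure HasFullCycles (𝕜 : Type*) [Field 𝕜] (d : ℕ) (K : PreAbstractSimplicialComplex α) :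
    Prop where
  finite : K.faces.Finite
  card_le : ∀ s ∈ K.augFaces, s.card ≤ d + 1
  exists_mem : ∀ x ∈ K.vertexSet, ∃ t ∈ K.augFaces, t.card = d + 1 ∧ x ∈ t
  apply_ne_zero : ∀ z ∈ K.cycles 𝕜 (d : ℤ), z ≠ 0 → ∀ t ∈ K.augFaces, t.card = d + 1 → z t ≠ 0

/-- Once the terms at `s` and `t` are subtracted from `z`, no set in the support contains `r`, so
the rest contributes nothing at `r`. -/
theorem boundary_apply_of_pair {z : Finset α →₀ 𝕜}
    {r s t : Finset α} (hst : s ≠ t) {x y : α} (hx : x ∈ s) (hy : y ∈ t)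
    (hr : ∀ u, z u ≠ 0 → r ⊆ u → u = s ∨ u = t) (hs : s.erase x = r) (ht : t.erase y = r) :
    boundary 𝕜 z r = z s * incidenceSign 𝕜 x s + z t * incidenceSign 𝕜 y t := by
  have h1 : z = z s • Finsupp.single s 1 + z t • Finsupp.single t 1 +
      (z - z s • Finsupp.single s 1 - z t • Finsupp.single t 1) := by abel
  have h2 : boundary 𝕜 (z - z s • Finsupp.single s 1 - z t • Finsupp.single t 1) r = 0 := by
    by_contra h
    obtain ⟨u, hu, w, -, hw⟩ := exists_of_boundary_apply_ne_zero h
    simp only [Finsupp.sub_apply, Finsupp.smul_apply, smul_eq_mul] at hu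
    by_cases hus : u = s
    · subst hus
      simp [Finsupp.single_eq_of_ne hst] at hu
    by_cases hut : u = t
    · subst hut
      simp [Finsupp.single_eq_of_ne hst.symm] at hu
    rw [Finsupp.single_eq_of_ne hus, Finsupp.single_eq_of_ne hut] at hu
    rcases hr u (by simpa using hu) (hw ▸ Finset.erase_subset _ _) with h | h
    · exact hus h
    · exact hut h
  conv_lhs => rw [h1]
  rw [map_add, map_add, map_smul, map_smul]
  simp only [Finsupp.add_apply, Finsupp.smul_apply, smul_eq_mul]
  rw [h2, add_zero]
  congr 2
  · rw [← hs, boundary_single_apply_erase hx]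
  · rw [← ht, boundary_single_apply_erase hy]

/-- At a ridge, ∂z = 0 is a relation with unit coefficients between the values of z at the two
facets there. A zero thus spreads to adjacent facets, and by strong connectivity to all facets. -/
theorem IsPseudoManifold.hasFullCycles {d : ℕ} (hd : 1 ≤ d) {K : PreAbstractSimplicialComplex α}
    (hK : K.IsPseudoManifold d) : K.HasFullCycles 𝕜 d where
  finite := hK.finite
  card_le := by
    rintro s (rfl | hs)
    · simp
    · obtain ⟨t, ht, hst⟩ := hK.pure s hs
      exact ht.2 ▸ Finset.card_le_card hst
  exists_mem x hx := by
    obtain ⟨t, ht, hst⟩ := hK.pure _ hx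
    exact ⟨t, Set.mem_insert_of_mem _ ht.1, ht.2, Finset.singleton_subset_iff.mp hst⟩
  apply_ne_zero := by
    have hmem : ∀ t ∈ K.augFaces, t.card = d + 1 → t ∈ K.dFaces d := fun t ht hc =>
      ⟨mem_faces_iff.mpr ⟨ht, Finset.card_pos.mp (by omega)⟩, hc⟩
    intro z hz hz0 t ht htc hzt
    have hadj : ∀ s t : K.dFaces d, (K.dualGraph d).Adj s t → z t = 0 → z s = 0 := by
      rintro ⟨s, hs⟩ ⟨t, ht⟩ ⟨hne, hst⟩ h0
      replace hne : s ≠ t := fun h => hne (Subtype.ext h)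
      change (s ∩ t).card = d at hst
      obtain ⟨x, hx⟩ : ∃ x, s \ t = {x} := Finset.card_eq_one.mp (by
        have := Finset.card_sdiff_add_card_inter s t
        have := hs.2
        omega)
      obtain ⟨y, hy⟩ : ∃ y, t \ s = {y} := Finset.card_eq_one.mp (by
        have := Finset.card_sdiff_add_card_inter t s
        rw [Finset.inter_comm] at this
        have := ht.2
        omega)
      have hxs : s.erase x = s ∩ t := by
        rw [← Finset.sdiff_singleton_eq_erase, ← hx, Finset.sdiff_sdiff_self_left]
      have hyt : t.erase y = s ∩ t := by
        rw [← Finset.sdiff_singleton_eq_erase, ← hy, Finset.sdiff_sdiff_self_left,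
          Finset.inter_comm s t]
      -- Since `1 ≤ d`, the ridge is nonempty, as membership in `faces` requires.
      have hr : s ∩ t ∈ K.faces := (K.isRelLowerSet_faces hs.1).2 Finset.inter_subset_left
        (Finset.card_pos.mp (by omega))
      have hpair := hK.ridge _ hr hst
      have hsub : ({s, t} : Set (Finset α)) = {u ∈ K.dFaces d | s ∩ t ⊆ u} := by
        refine Set.eq_of_subset_of_ncard_le ?_ ?_ ?_
        · rintro u (rfl | rfl)
          · exact ⟨hs, Finset.inter_subset_left⟩
          · exact ⟨ht, Finset.inter_subset_right⟩
        · rw [hpair, Set.ncard_pair hne]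
        · exact Set.finite_of_ncard_ne_zero (by omega)
      have h := boundary_apply_of_pair hne
        (Finset.mem_sdiff.mp (hx ▸ Finset.mem_singleton_self x)).1
        (Finset.mem_sdiff.mp (hy ▸ Finset.mem_singleton_self y)).1 (fun u hu hru => by
          obtain ⟨h1, h2⟩ := mem_chains.mp hz.1 u hu
          have : u ∈ ({s, t} : Set (Finset α)) := hsub ▸ ⟨hmem u h1 (by omega), hru⟩
          exact this) hxs hyt
      rw [LinearMap.mem_ker.mp hz.2, h0, zero_mul, add_zero] at h
      exact (mul_eq_zero.mp h.symm).resolve_right (incidenceSign_ne_zero 𝕜 _ _)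
    have hwalk : ∀ s t : K.dFaces d, (K.dualGraph d).Walk s t → z t = 0 → z s = 0 := by
      intro s t p
      induction p with
      | nil => exact id
      | cons h _ ih => exact fun h0 => hadj _ _ h (ih h0)
    refine hz0 (Finsupp.ext fun s => by_contra fun hs => hs ?_)
    obtain ⟨h1, h2⟩ := mem_chains.mp hz.1 s hs
    obtain ⟨p⟩ := hK.stronglyConnected.preconnected ⟨s, hmem s h1 (by omega)⟩ ⟨t, hmem t ht htc⟩
    exact hwalk _ _ p hzt

end PreAbstractSimplicialComplex

/-! ### Stacking a facet -/

namespace PreAbstractSimplicialComplex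
variable {α : Type*} [LinearOrder α] {𝕜 : Type*} [Field 𝕜]

/-- `K'` arises from `K` by stacking the facet `D` with the new vertex `v`. -/
structure IsStacking (K K' : PreAbstractSimplicialComplex α) (v : α) (D : Finset α) : Prop where
  notMem_vertexSet : v ∉ K.vertexSet
  mem : D ∈ K.faces
  mem_iff : ∀ t, t ∈ K'.augFaces ↔ (t ∈ K.augFaces ∧ t ≠ D) ∨ (v ∈ t ∧ t.erase v ⊂ D)

/-- The complex obtained from `K` by attaching the cone with apex `v` over the face `D`. -/
def attachCone (K : PreAbstractSimplicialComplex α) (v : α) (D : Finset α) (hD : D ∈ K.faces) :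
    PreAbstractSimplicialComplex α where
  faces := K.faces ∪ {s | v ∈ s ∧ s.erase v ⊆ D}
  isRelLowerSet_faces := by
    rintro s (hs | ⟨hv, hs⟩)
    · exact ⟨(K.isRelLowerSet_faces hs).1, fun t hts ht =>
        Or.inl ((K.isRelLowerSet_faces hs).2 hts ht)⟩
    · refine ⟨⟨v, hv⟩, fun t hts ht => ?_⟩
      by_cases hvt : v ∈ t
      · exact Or.inr ⟨hvt, (Finset.erase_subset_erase v hts).trans hs⟩
      · refine Or.inl ((K.isRelLowerSet_faces hD).2 (Finset.Subset.trans ?_ hs) ht)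
        exact Finset.subset_erase.mpr ⟨hts, hvt⟩

theorem mem_augFaces_attachCone {K : PreAbstractSimplicialComplex α} {v : α} {D : Finset α}
    (hD : D ∈ K.faces) {s : Finset α} :
    s ∈ (K.attachCone v D hD).augFaces ↔ s ∈ K.augFaces ∨ (v ∈ s ∧ s.erase v ⊆ D) :=
  or_assoc.symm

variable {K K' : PreAbstractSimplicialComplex α} {v : α} {D : Finset α}

namespace IsStacking

theorem notMem_of_mem (h : IsStacking K K' v D) {s : Finset α} (hs : s ∈ K.augFaces) : v ∉ s :=
  fun hv => h.notMem_vertexSet (mem_vertexSet_of_mem hs hv)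

theorem mem_augFaces (h : IsStacking K K' v D) : D ∈ K.augFaces := (mem_faces_iff.mp h.mem).1

theorem nonempty (h : IsStacking K K' v D) : D.Nonempty := (mem_faces_iff.mp h.mem).2

theorem notMem (h : IsStacking K K' v D) : v ∉ D := h.notMem_of_mem h.mem_augFaces

theorem coe_subset_vertexSet (h : IsStacking K K' v D) : (D : Set α) ⊆ K.vertexSet :=
  fun _ hx => mem_vertexSet_of_mem h.mem_augFaces hx

theorem vertexSet_eq (h : IsStacking K K' v D) (hD : 2 ≤ D.card) :
    K'.vertexSet = insert v K.vertexSet := by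
  ext x
  rw [Set.mem_insert_iff, mem_vertexSet_iff, mem_vertexSet_iff, h.mem_iff]
  have h1 : ({x} : Finset α) ≠ D := by
    rintro rfl
    simp at hD
  rw [and_iff_left h1, or_comm, Finset.mem_singleton, eq_comm]
  refine or_congr_left (and_iff_left_of_imp ?_)
  rintro rfl
  simpa using Finset.empty_ssubset.mpr h.nonempty

theorem induced_eq (h : IsStacking K K' v D) {W : Finset α} (hv : v ∉ W) (hD : ¬ D ⊆ W) :
    K'.induced W = K.induced W := by
  refine ext_augFaces fun s => ?_
  rw [mem_augFaces_induced, mem_augFaces_induced, h.mem_iff]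
  refine and_congr_left fun hs => ⟨?_, fun hK => Or.inl ⟨hK, ?_⟩⟩
  · rintro (h1 | h1)
    · exact h1.1
    · exact absurd (hs h1.1) hv
  · rintro rfl
    exact hD hs

theorem augFaces_induced_of_subset (h : IsStacking K K' v D) {W : Finset α} (hv : v ∉ W)
    (hD : D ⊆ W) :
    (K.induced W).augFaces = insert D (K'.induced W).augFaces ∧ D ∉ (K'.induced W).augFaces := by
  constructor
  · ext s
    rw [Set.mem_insert_iff, mem_augFaces_induced, mem_augFaces_induced, h.mem_iff]
    constructor
    · intro hs
      by_cases hsD : s = D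
      · exact Or.inl hsD
      · exact Or.inr ⟨Or.inl ⟨hs.1, hsD⟩, hs.2⟩
    · rintro (rfl | ⟨h1 | h1, h2⟩)
      · exact ⟨h.mem_augFaces, hD⟩
      · exact ⟨h1.1, h2⟩
      · exact absurd (h2 h1.1) hv
  · rw [mem_augFaces_induced, h.mem_iff]
    rintro ⟨h1 | h1, -⟩
    · exact h1.2 rfl
    · exact h.notMem h1.1

theorem augFaces_induced_of_disjoint (h : IsStacking K K' v D) {W : Finset α} (hv : v ∈ W)
    (hD : Disjoint D W) :
    (K'.induced W).augFaces = insert {v} (K.induced W).augFaces ∧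
      {v} ∉ (K.induced W).augFaces := by
  constructor
  · ext s
    rw [Set.mem_insert_iff, mem_augFaces_induced, mem_augFaces_induced, h.mem_iff]
    constructor
    · rintro ⟨h1 | h1, h2⟩
      · exact Or.inr ⟨h1.1, h2⟩
      · left
        have h3 : s.erase v = ∅ := Finset.disjoint_self_iff_empty _ |>.mp
          (hD.mono h1.2.subset ((Finset.erase_subset _ _).trans h2))
        rw [← Finset.insert_erase h1.1, h3]
        rfl
    · rintro (rfl | ⟨h1, h2⟩)
      · refine ⟨Or.inr ⟨Finset.mem_singleton_self v, ?_⟩, Finset.singleton_subset_iff.mpr hv⟩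
        simpa using Finset.empty_ssubset.mpr h.nonempty
      · refine ⟨Or.inl ⟨h1, ?_⟩, h2⟩
        rintro rfl
        exact h.nonempty.ne_empty (Finset.disjoint_self_iff_empty _ |>.mp (hD.mono_right h2))
  · rw [mem_augFaces_induced]
    exact fun h1 => h.notMem_of_mem h1.1 (Finset.mem_singleton_self v)

/-- Both complexes sit inside the one induced on `W` by `attachCone`. The faces missing from K[W]
contain `v` and are paired by toggling some a ∈ D ∩ W. Those missing from K'[W] can only be `D` and
`insert v D`, paired by toggling `v`. -/
theorem reducedBetti_induced_of_not_disjoint (h : IsStacking K K' v D) {W : Finset α} (hv : v ∈ W)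
    (hD : ¬ Disjoint D W) (i : ℤ) :
    (K'.induced W).reducedBetti 𝕜 i = (K.induced W).reducedBetti 𝕜 i := by
  obtain ⟨a, haD, haW⟩ := Finset.not_disjoint_iff.mp hD
  have hav : a ≠ v := fun hav => h.notMem (hav ▸ haD)
  have hfin := finite_faces_induced (K.attachCone v D h.mem) W
  rw [← reducedBetti_eq_of_toggle (L := K.induced W) hfin _ a,
    ← reducedBetti_eq_of_toggle (L := K'.induced W) hfin _ v]
  · intro s hs hs'
    rw [mem_augFaces_induced, mem_augFaces_attachCone] at hs ⊢
    rw [mem_augFaces_induced, h.mem_iff] at hs'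
    refine ⟨Or.inr ⟨Finset.mem_insert_self _ _, ?_⟩, Finset.insert_subset hv hs.2⟩
    rw [Finset.erase_insert_eq_erase]
    rcases hs.1 with h1 | h1
    · have : s = D := by_contra fun hne => hs' ⟨Or.inl ⟨h1, hne⟩, hs.2⟩
      exact this ▸ Finset.erase_subset _ _
    · exact h1.2
  · intro s hs hs'
    rw [mem_augFaces_induced, mem_augFaces_attachCone] at hs
    rw [mem_augFaces_induced, h.mem_iff] at hs' ⊢
    have : s.erase v = D := by
      rcases hs.1 with h1 | h1
      · have : s = D := by_contra fun hne => hs' ⟨Or.inl ⟨h1, hne⟩, hs.2⟩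
        rw [this, Finset.erase_eq_of_notMem h.notMem]
      · exact by_contra fun hne => hs' ⟨Or.inr ⟨h1.1, h1.2.ssubset_of_ne hne⟩, hs.2⟩
    rw [this]
    rintro ⟨h1 | h1, -⟩
    · exact h1.2 rfl
    · exact h.notMem h1.1
  · intro s hs
    rw [mem_augFaces_induced, h.mem_iff] at hs
    rw [mem_augFaces_induced, mem_augFaces_attachCone]
    exact ⟨hs.1.imp And.left (And.imp_right fun h1 => h1.subset), hs.2⟩
  · intro s hs hs'
    rw [mem_augFaces_induced, mem_augFaces_attachCone] at hs ⊢
    rw [mem_augFaces_induced] at hs'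
    have h1 := hs.1.resolve_left fun h1 => hs' ⟨h1, hs.2⟩
    refine ⟨Or.inr ⟨Finset.mem_insert_of_mem h1.1, ?_⟩, Finset.insert_subset haW hs.2⟩
    rw [Finset.erase_insert_of_ne hav]
    exact Finset.insert_subset haD h1.2
  · intro s hs hs'
    rw [mem_augFaces_induced, mem_augFaces_attachCone] at hs
    rw [mem_augFaces_induced] at hs' ⊢
    have h1 := hs.1.resolve_left fun h1 => hs' ⟨h1, hs.2⟩
    exact fun h2 => h.notMem_of_mem h2.1 (Finset.mem_erase.mpr ⟨hav.symm, h1.1⟩)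
  · intro s hs
    rw [mem_augFaces_induced] at hs
    rw [mem_augFaces_induced, mem_augFaces_attachCone]
    exact ⟨Or.inl hs.1, hs.2⟩

/-! ### Effect on Betti numbers of induced subcomplexes -/

/-- If W contains v and misses D, then v is a new component. For W = {v} there is nothing else in
K[W] and degree -1 drops instead. Removing D affects only degrees |D| - 2 and |D| - 1, both
positive. -/
theorem reducedBetti_induced_zero (h : IsStacking K K' v D) (hD : 3 ≤ D.card) {W : Finset α}
    (hW : (W : Set α) ⊆ insert v K.vertexSet) :
    ((K'.induced W).reducedBetti 𝕜 0 : ℚ) = (K.induced W).reducedBetti 𝕜 0 +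
      ((if v ∈ W ∧ Disjoint D W then 1 else 0) - (if W = {v} then 1 else 0)) := by
  by_cases hv : v ∈ W
  · by_cases hDW : Disjoint D W
    · obtain ⟨h1, h2⟩ := h.augFaces_induced_of_disjoint hv hDW
      by_cases hWv : W = {v}
      · rw [(reducedBetti_of_forall_cycles (𝕜 := 𝕜) (m := 0) (finite_faces_induced K' W) h1 h2
          (by simp) ?_).1, if_pos ⟨hv, hDW⟩, if_pos hWv, sub_self, add_zero]
        intro z hz
        have h3 : z = z {v} • Finsupp.single {v} 1 := by
          ext s
          by_cases hs : s = {v}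
          · simp [hs]
          · rw [Finsupp.smul_apply, Finsupp.single_eq_of_ne hs, smul_zero]
            by_contra h0
            obtain ⟨h4, h5⟩ := mem_chains.mp hz.1 s h0
            rw [mem_augFaces_induced, hWv, Finset.subset_singleton_iff] at h4
            rcases h4.2 with rfl | h4
            · simp at h5
            · exact hs h4
        have h4 := LinearMap.mem_ker.mp hz.2
        rw [h3, map_smul, boundary_single] at h4
        simpa [incidenceSign] using DFunLike.congr_fun h4 ∅
      · obtain ⟨u, hu, huv⟩ : ∃ u ∈ W, u ≠ v := by
          by_contra! hall
          exact hWv (Finset.eq_singleton_iff_unique_mem.mpr ⟨hv, hall⟩)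
        have huK : {u} ∈ K.augFaces := mem_vertexSet_iff.mp ((hW hu).resolve_left huv)
        -- The difference of two vertices is a reduced 0-cycle through the new vertex.
        have hz : Finsupp.single {v} 1 - Finsupp.single {u} 1 ∈ (K'.induced W).cycles 𝕜 0 := by
          refine ⟨Submodule.sub_mem _ ?_ ?_, ?_⟩
          · exact Finsupp.single_mem_supported 𝕜 _ ⟨h1 ▸ Set.mem_insert _ _, by simp⟩
          · refine Finsupp.single_mem_supported 𝕜 _ ⟨h1 ▸ Set.mem_insert_of_mem _ ?_, by simp⟩
            exact mem_augFaces_induced.mpr ⟨huK, Finset.singleton_subset_iff.mpr hu⟩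
          · rw [SetLike.mem_coe, LinearMap.mem_ker, map_sub, boundary_single, boundary_single]
            simp [incidenceSign, Finset.filter_singleton]
        rw [(reducedBetti_of_mem_cycles (𝕜 := 𝕜) (m := 0) (finite_faces_induced K' W) h1 h2
          (by simp) hz ?_).1, if_pos ⟨hv, hDW⟩, if_neg hWv, sub_zero, Nat.cast_add, Nat.cast_one]
        have hne : ({v} : Finset α) ≠ {u} := fun e => huv (Finset.singleton_injective e).symm
        simp [Finsupp.single_eq_of_ne hne]
    · have hWv : W ≠ {v} := by
        rintro rfl
        exact hDW (Finset.disjoint_singleton_right.mpr h.notMem)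
      rw [h.reducedBetti_induced_of_not_disjoint hv hDW, if_neg fun h1 => hDW h1.2, if_neg hWv,
        sub_zero, add_zero]
  · have hWv : W ≠ {v} := by
      rintro rfl
      exact hv (Finset.mem_singleton_self v)
    rw [if_neg fun h1 => hv h1.1, if_neg hWv, sub_zero, add_zero]
    by_cases hDW : D ⊆ W
    · rw [reducedBetti_of_augFaces_eq_insert (m := (D.card : ℤ) - 1)
        (h.augFaces_induced_of_subset hv hDW).1 (by omega) (by omega) (by omega)]
    · rw [h.induced_eq hv hDW]

/-- The single faces gained or lost have dimension 0 or |D| - 1, so only degrees -1, 0, |D| - 2 and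
|D| - 1 can change. -/
theorem reducedBetti_induced_middle (h : IsStacking K K' v D) (W : Finset α) {i : ℤ} (hi : 1 ≤ i)
    (hi' : i + 3 ≤ D.card) :
    (K'.induced W).reducedBetti 𝕜 i = (K.induced W).reducedBetti 𝕜 i := by
  by_cases hv : v ∈ W
  · by_cases hDW : Disjoint D W
    · exact reducedBetti_of_augFaces_eq_insert (m := 0)
        (h.augFaces_induced_of_disjoint hv hDW).1 (by simp) (by omega) (by omega)
    · exact h.reducedBetti_induced_of_not_disjoint hv hDW i
  · by_cases hDW : D ⊆ W
    · exact (reducedBetti_of_augFaces_eq_insert (m := (D.card : ℤ) - 1)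
        (h.augFaces_induced_of_subset hv hDW).1 (by omega) (by omega) (by omega)).symm
    · rw [h.induced_eq hv hDW]

/-- When v ∉ W ⊇ D, adding D to K'[W] gives K[W]. For W = V the given d-cycle passes through D, so
degree d - 1 is unchanged. A d-cycle of K[W] through D would use every facet and hence every vertex,
so for W ≠ V none exists and D kills a class. -/
theorem reducedBetti_induced_codim_one {d : ℕ} (hK : K.HasFullCycles 𝕜 d)
    (hor : ∃ z ∈ K.cycles 𝕜 (d : ℤ), z ≠ 0) (h : IsStacking K K' v D) (hd : 2 ≤ d)
    (hD : D.card = d + 1) {V : Finset α} (hV : V = K.vertexSet) {W : Finset α}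
    (hW : W ⊆ insert v V) :
    ((K'.induced W).reducedBetti 𝕜 ((d : ℤ) - 1) : ℚ) =
      (K.induced W).reducedBetti 𝕜 ((d : ℤ) - 1) +
        ((if v ∉ W ∧ D ⊆ W then 1 else 0) - (if W = V then 1 else 0)) := by
  have hvV : v ∉ V := fun hv => h.notMem_vertexSet (hV ▸ Finset.mem_coe.mpr hv)
  by_cases hv : v ∈ W
  · rw [if_neg fun h1 => h1.1 hv, if_neg fun h1 : W = V => hvV (h1 ▸ hv),
      sub_zero, add_zero]
    by_cases hDW : Disjoint D W
    · rw [reducedBetti_of_augFaces_eq_insert (m := 0)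
        (h.augFaces_induced_of_disjoint hv hDW).1 (by simp) (by omega) (by omega)]
    · rw [h.reducedBetti_induced_of_not_disjoint hv hDW]
  · have hWV : W ⊆ V := (Finset.subset_insert_iff_of_notMem hv).mp hW
    by_cases hDW : D ⊆ W
    · obtain ⟨h1, h2⟩ := h.augFaces_induced_of_subset hv hDW
      rw [if_pos ⟨hv, hDW⟩]
      by_cases hWeq : W = V
      · rw [if_pos hWeq, sub_self, add_zero]
        obtain ⟨z, hz, hz0⟩ := hor
        have hz' : z ∈ (K.induced W).cycles 𝕜 (d : ℤ) := by
          refine ⟨mem_chains.mpr fun s hs => ?_, hz.2⟩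
          obtain ⟨h3, h4⟩ := mem_chains.mp hz.1 s hs
          refine ⟨mem_augFaces_induced.mpr ⟨h3, fun x hx => ?_⟩, h4⟩
          rw [hWeq, ← Finset.mem_coe, hV]
          exact mem_vertexSet_of_mem h3 hx
        rw [(reducedBetti_of_mem_cycles (𝕜 := 𝕜) (m := d) (finite_faces_induced K W) h1 h2
          (by omega) hz' (hK.apply_ne_zero z hz hz0 D h.mem_augFaces hD)).2 _ (by omega)]
      · rw [if_neg hWeq, sub_zero, ← (reducedBetti_of_forall_cycles (𝕜 := 𝕜) (m := d)
          (finite_faces_induced K W) h1 h2 (by omega) ?_).2 _ (sub_add_cancel _ _), Nat.cast_add,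
          Nat.cast_one]
        intro z hz
        by_contra hzD
        refine hWeq (hWV.antisymm fun x hx => ?_)
        obtain ⟨t, ht, htc, hxt⟩ := hK.exists_mem x (hV ▸ Finset.mem_coe.mpr hx)
        have hzK : z ∈ K.cycles 𝕜 (d : ℤ) :=
          cycles_mono (fun s hs => (mem_augFaces_induced.mp hs).1) _ hz
        have hzt := hK.apply_ne_zero z hzK (fun h0 => hzD (by simp [h0])) t ht htc
        exact (mem_augFaces_induced.mp (mem_chains.mp hz.1 t hzt).1).2 hxt
    · have hWne : W ≠ V := by
        rintro rfl
        exact hDW fun x hx => by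
          rw [← Finset.mem_coe, hV]
          exact h.coe_subset_vertexSet hx
      rw [if_neg fun h1 => hDW h1.2, if_neg hWne, sub_zero, add_zero, h.induced_eq hv hDW]

end IsStacking

end PreAbstractSimplicialComplex

/-! ### Persistence of full cycles under stacking, and iteration -/

namespace PreAbstractSimplicialComplex
variable {α : Type*} [LinearOrder α] {𝕜 : Type*} [Field 𝕜]
variable {K K' : PreAbstractSimplicialComplex α} {v : α} {D : Finset α} {d : ℕ}

namespace IsStacking

/-- Inside `attachCone`, `z` is pushed into `K` by coning from a vertex of `D`. The only (d+1)-face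
outside `K` is `insert v D`, so the correction is a multiple of its boundary. -/
theorem exists_sub_smul_boundary_mem_cycles (h : IsStacking K K' v D) (hD : D.card = d + 1)
    {z : Finset α →₀ 𝕜} (hz : z ∈ K'.cycles 𝕜 (d : ℤ)) :
    ∃ c : 𝕜, z - c • boundary 𝕜 (Finsupp.single (insert v D) 1) ∈ K.cycles 𝕜 (d : ℤ) := by
  obtain ⟨a, ha⟩ := h.nonempty
  have hav : a ≠ v := fun hav => h.notMem (hav ▸ ha)
  have hz' : z ∈ (K.attachCone v D h.mem).chains 𝕜 (d : ℤ) := by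
    refine chains_mono (fun s hs => ?_) _ hz.1
    rw [h.mem_iff] at hs
    rw [mem_augFaces_attachCone]
    exact hs.imp And.left (And.imp_right fun h1 => h1.subset)
  obtain ⟨w, hw, hwK, hzw⟩ := exists_sub_boundary_mem_chains (L := K) a
    (fun s hs hs' => by
      rw [mem_augFaces_attachCone] at hs ⊢
      have h1 := hs.resolve_left hs'
      refine Or.inr ⟨Finset.mem_insert_of_mem h1.1, ?_⟩
      rw [Finset.erase_insert_of_ne hav]
      exact Finset.insert_subset ha h1.2)
    (fun s hs hs' => by
      rw [mem_augFaces_attachCone] at hs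
      have h1 := hs.resolve_left hs'
      exact fun h2 => h.notMem_of_mem h2 (Finset.mem_erase.mpr ⟨hav.symm, h1.1⟩))
    hz' (fun t ht => absurd (by rw [LinearMap.mem_ker.mp hz.2]; rfl) ht)
  have hw' : w = w (insert v D) • Finsupp.single (insert v D) 1 := by
    ext s
    by_cases hs : s = insert v D
    · simp [hs]
    · rw [Finsupp.smul_apply, Finsupp.single_eq_of_ne hs, smul_zero]
      by_contra h0
      obtain ⟨h1, h2⟩ := mem_chains.mp hw s h0
      rw [mem_augFaces_attachCone] at h1
      have h3 := h1.resolve_left (hwK s h0)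
      refine hs ?_
      have h4 := Finset.card_erase_add_one h3.1
      rw [← Finset.eq_of_subset_of_card_le h3.2 (by omega), Finset.insert_erase h3.1]
  refine ⟨w (insert v D), ?_, ?_⟩
  · rwa [← map_smul, ← hw']
  · rw [SetLike.mem_coe, LinearMap.mem_ker, map_sub, map_smul, boundary_boundary,
      LinearMap.mem_ker.mp hz.2, smul_zero, sub_zero]

theorem boundary_single_insert_apply_ne_zero (h : IsStacking K K' v D) :
    boundary 𝕜 (Finsupp.single (insert v D) 1) D ≠ 0 := by
  have h1 := boundary_single_apply_erase (𝕜 := 𝕜) (Finset.mem_insert_self v D)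
  rw [Finset.erase_insert h.notMem] at h1
  rw [h1]
  exact incidenceSign_ne_zero 𝕜 _ _

theorem exists_erase_eq (h : IsStacking K K' v D) (hD : D.card = d + 1) {t : Finset α}
    (ht : v ∈ t) (htD : t.erase v ⊂ D) (hc : t.card = d + 1) :
    ∃ x ∈ insert v D, (insert v D).erase x = t := by
  obtain ⟨a, haD, hat⟩ := Finset.exists_of_ssubset htD
  refine ⟨a, Finset.mem_insert_of_mem haD, ?_⟩
  have h1 : t.erase v = D.erase a := by
    refine Finset.eq_of_subset_of_card_le (Finset.subset_erase.mpr ⟨htD.subset, hat⟩) ?_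
    rw [Finset.card_erase_of_mem haD, Finset.card_erase_of_mem ht]
    omega
  rw [Finset.erase_insert_of_ne fun hva : v = a => h.notMem (hva ▸ haD), ← h1, Finset.insert_erase ht]

theorem boundary_single_insert_apply_eq_zero (h : IsStacking K K' v D) {t : Finset α}
    (ht : v ∉ t) (htD : t ≠ D) : boundary 𝕜 (Finsupp.single (insert v D) 1) t = 0 := by
  by_contra h0
  obtain ⟨x, -, rfl⟩ := exists_of_boundary_single_apply_ne_zero h0
  by_cases hx : x = v
  · subst hx
    exact htD (Finset.erase_insert h.notMem)
  · exact ht (Finset.mem_erase.mpr ⟨Ne.symm hx, Finset.mem_insert_self v D⟩)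

/-- A nonzero cycle z of K' vanishes at D and equals a cycle of K plus c∂(D ∪ {v}). Here c ≠ 0, as
otherwise z would be a nonzero cycle of K missing D. So z is ±c on the new facets, and on the old
ones it agrees with a nonzero cycle of K. -/
theorem hasFullCycles (hK : K.HasFullCycles 𝕜 d) (h : IsStacking K K' v D) (hd : 1 ≤ d)
    (hD : D.card = d + 1) : K'.HasFullCycles 𝕜 d where
  finite := by
    refine (hK.finite.union ((insert v D).powerset.finite_toSet)).subset fun s hs => ?_
    obtain ⟨h1, h2⟩ := mem_faces_iff.mp hs
    rcases (h.mem_iff s).mp h1 with h3 | h3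
    · exact Or.inl (mem_faces_iff.mpr ⟨h3.1, h2⟩)
    · exact Or.inr (Finset.mem_coe.mpr (Finset.mem_powerset.mpr
        (Finset.subset_insert_iff.mpr h3.2.subset)))
  card_le s hs := by
    rcases (h.mem_iff s).mp hs with h3 | h3
    · exact hK.card_le s h3.1
    · have h1 := Finset.card_lt_card h3.2
      have h2 := Finset.card_erase_add_one h3.1
      omega
  exists_mem x hx := by
    have hnew : ∀ y ∈ D, insert v (D.erase y) ∈ K'.augFaces ∧
        (insert v (D.erase y)).card = d + 1 := by
      intro y hy
      have h1 : v ∉ D.erase y := fun h1 => h.notMem (Finset.mem_of_mem_erase h1)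
      refine ⟨(h.mem_iff _).mpr (Or.inr ⟨Finset.mem_insert_self _ _, ?_⟩), ?_⟩
      · rw [Finset.erase_insert h1]
        exact Finset.erase_ssubset hy
      · rw [Finset.card_insert_of_notMem h1, Finset.card_erase_add_one hy, hD]
    rw [h.vertexSet_eq (by omega)] at hx
    rcases hx with rfl | hx
    · obtain ⟨y, hy⟩ := h.nonempty
      exact ⟨_, (hnew y hy).1, (hnew y hy).2, Finset.mem_insert_self _ _⟩
    · obtain ⟨t, ht, hc, hxt⟩ := hK.exists_mem x hx
      by_cases htD : t = D
      · subst htD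
        -- If the facet through `x` was the removed one, the new facet omitting another vertex `y`
        -- still contains `x`.
        obtain ⟨y, hy, hyx⟩ := Finset.exists_mem_ne (by omega : 1 < t.card) x
        exact ⟨_, (hnew y hy).1, (hnew y hy).2,
          Finset.mem_insert_of_mem (Finset.mem_erase.mpr ⟨hyx.symm, hxt⟩)⟩
      · exact ⟨t, (h.mem_iff t).mpr (Or.inl ⟨ht, htD⟩), hc, hxt⟩
  apply_ne_zero z hz hz0 t ht htc := by
    obtain ⟨c, hc⟩ := h.exists_sub_smul_boundary_mem_cycles hD hz
    have hzD : z D = 0 := by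
      by_contra hzD
      rcases (h.mem_iff D).mp (mem_chains.mp hz.1 D hzD).1 with h1 | h1
      · exact h1.2 rfl
      · exact h.notMem h1.1
    have hc0 : c ≠ 0 := by
      rintro rfl
      rw [zero_smul, sub_zero] at hc
      exact hK.apply_ne_zero z hc hz0 D h.mem_augFaces hD hzD
    have hne : z - c • boundary 𝕜 (Finsupp.single (insert v D) 1) ≠ 0 := by
      intro h0
      have h1 := DFunLike.congr_fun h0 D
      rw [Finsupp.sub_apply, Finsupp.smul_apply, hzD, zero_sub, smul_eq_mul, Finsupp.zero_apply,
        neg_eq_zero] at h1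
      exact mul_ne_zero hc0 h.boundary_single_insert_apply_ne_zero h1
    rcases (h.mem_iff t).mp ht with h1 | h1
    · have h2 := hK.apply_ne_zero _ hc hne t h1.1 htc
      rwa [Finsupp.sub_apply, Finsupp.smul_apply,
        h.boundary_single_insert_apply_eq_zero (h.notMem_of_mem h1.1) h1.2, smul_zero,
        sub_zero] at h2
    · obtain ⟨x, hx, rfl⟩ := h.exists_erase_eq hD h1.1 h1.2 htc
      have h2 : (z - c • boundary 𝕜 (Finsupp.single (insert v D) 1)) ((insert v D).erase x) = 0 :=
        by_contra fun h2 => h.notMem_of_mem (mem_chains.mp hc.1 _ h2).1 h1.1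
      rw [Finsupp.sub_apply, Finsupp.smul_apply, boundary_single_apply_erase hx, sub_eq_zero] at h2
      rw [h2]
      exact mul_ne_zero hc0 (incidenceSign_ne_zero 𝕜 _ _)

/-- Subtracting the multiple of ∂(D ∪ {v}) that cancels the coefficient at D moves the cycle into
K'. It stays nonzero on the new facets, where the old cycle vanishes. -/
theorem exists_cycle_ne_zero (hK : K.HasFullCycles 𝕜 d) (h : IsStacking K K' v D)
    (hD : D.card = d + 1) (hor : ∃ z ∈ K.cycles 𝕜 (d : ℤ), z ≠ 0) :
    ∃ z ∈ K'.cycles 𝕜 (d : ℤ), z ≠ 0 := by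
  obtain ⟨z, hz, hz0⟩ := hor
  have hzD := hK.apply_ne_zero z hz hz0 D h.mem_augFaces hD
  set b := boundary 𝕜 (Finsupp.single (insert v D) 1) with hb
  have hbD : b D ≠ 0 := h.boundary_single_insert_apply_ne_zero
  obtain ⟨a, ha⟩ := h.nonempty
  have hcard : (insert v D).card = d + 2 := by rw [Finset.card_insert_of_notMem h.notMem, hD]
  refine ⟨z - (z D / b D) • b, ⟨mem_chains.mpr fun t ht => ?_, ?_⟩, fun h0 => ?_⟩
  · have htD : t ≠ D := by
      rintro rfl
      simp [hbD] at ht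
    by_cases hzt : z t = 0
    · have hbt : b t ≠ 0 := by
        intro h0
        simp [hzt, h0] at ht
      obtain ⟨x, hx, rfl⟩ := exists_of_boundary_single_apply_ne_zero hbt
      have hxv : x ≠ v := by
        rintro rfl
        exact htD (Finset.erase_insert h.notMem)
      have hxD : x ∈ D := Finset.mem_of_mem_insert_of_ne hx hxv
      constructor
      · refine (h.mem_iff _).mpr (Or.inr
          ⟨Finset.mem_erase.mpr ⟨hxv.symm, Finset.mem_insert_self _ _⟩, ?_⟩)
        rw [Finset.erase_right_comm, Finset.erase_insert h.notMem]
        exact Finset.erase_ssubset hxD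
      · have := Finset.card_erase_add_one hx
        omega
    · obtain ⟨h1, h2⟩ := mem_chains.mp hz.1 t hzt
      exact ⟨(h.mem_iff t).mpr (Or.inl ⟨h1, htD⟩), h2⟩
  · rw [SetLike.mem_coe, LinearMap.mem_ker, map_sub, map_smul, hb, boundary_boundary,
      LinearMap.mem_ker.mp hz.2, smul_zero, sub_zero]
  · have hav : a ≠ v := fun hav => h.notMem (hav ▸ ha)
    have h1 := DFunLike.congr_fun h0 ((insert v D).erase a)
    have hz1 : z ((insert v D).erase a) = 0 := by_contra fun h2 =>
      h.notMem_of_mem (mem_chains.mp hz.1 _ h2).1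
        (Finset.mem_erase.mpr ⟨hav.symm, Finset.mem_insert_self _ _⟩)
    rw [Finsupp.sub_apply, Finsupp.smul_apply, hz1, zero_sub, Finsupp.zero_apply, neg_eq_zero, hb,
      boundary_single_apply_erase (Finset.mem_insert_of_mem ha)] at h1
    exact mul_ne_zero (div_ne_zero hzD hbD) (incidenceSign_ne_zero 𝕜 _ _) h1

/-! ### Effect on the `τ`-vector -/

variable {V : Finset α}

theorem notMem_of_coe_eq (h : IsStacking K K' v D) (hV : V = K.vertexSet) : v ∉ V :=
  fun hv => h.notMem_vertexSet (hV ▸ Finset.mem_coe.mpr hv)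

theorem insert_subset_of_coe_eq (h : IsStacking K K' v D) (hV : V = K.vertexSet) :
    insert v D ⊆ insert v V :=
  Finset.insert_subset_insert v (Finset.coe_subset.mp (hV ▸ h.coe_subset_vertexSet))

/-- Both complexes are averaged over the subsets of `insert v V`. The last term is the weight of the
exceptional singleton {v} among |V| + 1 elements. -/
theorem tau_zero (h : IsStacking K K' v D) (hD : 3 ≤ D.card) (hV : V = K.vertexSet) :
    K'.tau 𝕜 (insert v V) 0 = K.tau 𝕜 V 0 + (1 / (((D.card : ℚ) + 1) * ((D.card : ℚ) + 2)) -
      1 / (((V.card : ℚ) + 2) * ((V.card : ℚ) + 1))) := by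
  rw [← tau_eq_of_subset (V := insert v V) hV.superset (Finset.subset_insert v V),
    tau_eq_levelAverage, tau_eq_levelAverage,
    ← Finset.levelAverage_disjoint_mem h.notMem (h.insert_subset_of_coe_eq hV),
    Finset.levelAverage_congr fun W hW => h.reducedBetti_induced_zero hD
      (by rw [← hV]; exact_mod_cast hW),
    Finset.levelAverage_add, Finset.levelAverage_sub,
    Finset.levelAverage_ite_eq (Finset.singleton_subset_iff.mpr (Finset.mem_insert_self v V)),
    Finset.card_insert_of_notMem (h.notMem_of_coe_eq hV), Finset.card_singleton,
    Nat.choose_one_right]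
  push_cast
  ring_nf

theorem tau_middle (h : IsStacking K K' v D) (hV : V = K.vertexSet) {i : ℤ} (hi : 1 ≤ i)
    (hi' : i + 3 ≤ D.card) : K'.tau 𝕜 (insert v V) i = K.tau 𝕜 V i := by
  rw [← tau_eq_of_subset (V := insert v V) hV.superset (Finset.subset_insert v V),
    tau_eq_levelAverage, tau_eq_levelAverage]
  exact Finset.levelAverage_congr fun W _ => by rw [h.reducedBetti_induced_middle W hi hi']

/-- The exceptional set is now `V`, the complement of {v} in the ground set, so its weight is that
of a singleton. -/
theorem tau_codim_one (hK : K.HasFullCycles 𝕜 d) (hor : ∃ z ∈ K.cycles 𝕜 (d : ℤ), z ≠ 0)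
    (h : IsStacking K K' v D) (hd : 2 ≤ d) (hD : D.card = d + 1) (hV : V = K.vertexSet) :
    K'.tau 𝕜 (insert v V) ((d : ℤ) - 1) = K.tau 𝕜 V ((d : ℤ) - 1) +
      (1 / (((D.card : ℚ) + 1) * ((D.card : ℚ) + 2)) -
        1 / (((V.card : ℚ) + 2) * ((V.card : ℚ) + 1))) := by
  rw [← tau_eq_of_subset (V := insert v V) hV.superset (Finset.subset_insert v V),
    tau_eq_levelAverage, tau_eq_levelAverage,
    ← Finset.levelAverage_superset_notMem h.notMem (h.insert_subset_of_coe_eq hV),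
    Finset.levelAverage_congr fun W hW => h.reducedBetti_induced_codim_one hK hor hd hD hV hW,
    Finset.levelAverage_add, Finset.levelAverage_sub,
    Finset.levelAverage_ite_eq (Finset.subset_insert v V),
    Finset.card_insert_of_notMem (h.notMem_of_coe_eq hV), Nat.choose_succ_self_right]
  push_cast
  ring_nf

end IsStacking

/-- A bistellar flip of type `(1, d + 1)` stacks a facet. -/
theorem IsBistellarFlip.exists_isStacking (h : IsBistellarFlip 1 (d + 1) K K')
    (hK : K.HasFullCycles 𝕜 d) : ∃ v D, D.card = d + 1 ∧ IsStacking K K' v D := by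
  obtain ⟨F, D, -, hD, hdisj, hF, hDc, hind, hfaces⟩ := h
  obtain ⟨v, rfl⟩ := Finset.card_eq_one.mp hF
  have hvD : v ∉ D := Finset.disjoint_singleton_left.mp hdisj
  have hmem : ∀ s, s ∈ K.faces ∧ s ⊆ {v} ∪ D ↔ s.Nonempty ∧ s ⊆ {v} ∪ D ∧ ¬ {v} ⊆ s := by
    intro s
    have h1 : s ∈ (K.induced ({v} ∪ D)).faces ↔ s ∈ (flipBall ({v} ∪ D) {v}).faces := by rw [hind]
    exact h1
  have hDK : D ∈ K.faces := ((hmem D).mpr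
    ⟨hD, Finset.subset_union_right, by rwa [Finset.singleton_subset_iff]⟩).1
  refine ⟨v, D, hDc, fun hv => ((hmem {v}).mp ⟨hv, Finset.subset_union_left⟩).2.2 subset_rfl, hDK,
    fun t => ?_⟩
  have hfaces' : t ∈ K'.faces ↔ (t ∈ K.faces ∧ ¬ D ⊆ t) ∨
      (t.Nonempty ∧ t ⊆ {v} ∪ D ∧ ¬ D ⊆ t) := by
    rw [hfaces]
    rfl
  -- The flip deletes all faces containing `D`; by dimension, `D` is the only one.
  have hDt : t ∈ K.augFaces → (D ⊆ t ↔ t = D) := fun ht =>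
    ⟨fun h1 => (Finset.eq_of_subset_of_card_le h1 (hDc ▸ hK.card_le t ht)).symm,
      fun h1 => h1.superset⟩
  have hsub : v ∈ t → (t.erase v ⊂ D ↔ t ⊆ {v} ∪ D ∧ ¬ D ⊆ t) := by
    intro hv
    rw [ssubset_iff_subset_not_subset, Finset.subset_erase, and_iff_left hvD, Finset.union_comm,
      ← Finset.subset_insert_iff, Finset.union_singleton]
  rcases t.eq_empty_or_nonempty with rfl | hne
  · exact iff_of_true (empty_mem_augFaces _) (Or.inl ⟨empty_mem_augFaces _, hD.ne_empty.symm⟩)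
  · have hiff : ∀ L : PreAbstractSimplicialComplex α, t ∈ L.augFaces ↔ t ∈ L.faces := fun L => by
      rw [mem_faces_iff, and_iff_left hne]
    rw [hiff, hiff, hfaces']
    constructor
    · rintro (⟨h1, h2⟩ | ⟨-, h1, h2⟩)
      · exact Or.inl ⟨h1, fun h3 => h2 h3.superset⟩
      · by_cases hv : v ∈ t
        · exact Or.inr ⟨hv, (hsub hv).mpr ⟨h1, h2⟩⟩
        · exact Or.inl ⟨((hmem t).mpr ⟨hne, h1, by rwa [Finset.singleton_subset_iff]⟩).1,
            fun h3 => h2 h3.superset⟩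
    · rintro (⟨h1, h2⟩ | ⟨hv, h1⟩)
      · exact Or.inl ⟨h1, fun h3 => h2 ((hDt ((hiff K).mpr h1)).mp h3)⟩
      · exact Or.inr ⟨hne, (hsub hv).mp h1⟩

theorem IsOrientable.exists_cycle_ne_zero (h : K.IsOrientable 𝕜 d)
    (hK : K.IsPseudoManifold d) : ∃ z ∈ K.cycles 𝕜 (d : ℤ), z ≠ 0 := by
  obtain ⟨z, hz, hz1⟩ := h
  obtain ⟨⟨s, hs⟩⟩ := hK.stronglyConnected.nonempty
  refine ⟨z, hz, ?_⟩
  rintro rfl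
  simpa using hz1 s hs

/-- The effect of `k` stacking moves, with the vertex sets as ground sets. -/
theorem ObtainedByFlips.tau_eq {M N : PreAbstractSimplicialComplex α} {k : ℕ}
    (h : ObtainedByFlips 1 (d + 1) M k N) (hd : 2 ≤ d) (hM : M.HasFullCycles 𝕜 d) {U : Finset α}
    (hU : U = M.vertexSet) :
    ∃ U' : Finset α, U' = N.vertexSet ∧ U'.card = U.card + k ∧ N.HasFullCycles 𝕜 d ∧
      N.tau 𝕜 U' 0 = M.tau 𝕜 U 0 + (k : ℚ) / (((d : ℚ) + 2) * ((d : ℚ) + 3)) -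
        1 / ((U.card : ℚ) + 1) + 1 / ((U.card : ℚ) + (k : ℚ) + 1) ∧
      ((∃ z ∈ M.cycles 𝕜 (d : ℤ), z ≠ 0) → (∃ z ∈ N.cycles 𝕜 (d : ℤ), z ≠ 0) ∧
        N.tau 𝕜 U' ((d : ℤ) - 1) = M.tau 𝕜 U ((d : ℤ) - 1) +
          (k : ℚ) / (((d : ℚ) + 2) * ((d : ℚ) + 3)) -
            1 / ((U.card : ℚ) + 1) + 1 / ((U.card : ℚ) + (k : ℚ) + 1)) ∧
      ∀ i : ℤ, 1 ≤ i → i ≤ (d : ℤ) - 2 → N.tau 𝕜 U' i = M.tau 𝕜 U i := by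
  induction h with
  | refl => exact ⟨U, hU, rfl, hM, by simp, fun h => ⟨h, by simp⟩, fun _ _ _ => rfl⟩
  | @step k N N' _ hflip ih =>
    obtain ⟨U', hU', hcard, hN, h0, hor, hmid⟩ := ih
    obtain ⟨v, D, hD, hst⟩ := hflip.exists_isStacking hN
    have hvU := hst.notMem_of_coe_eq hU'
    -- The exceptional weight telescopes: with m = |U| + k, 1/((m+1)(m+2)) = 1/(m+1) - 1/(m+2).
    have harith : ∀ x : ℚ, x + (k : ℚ) / (((d : ℚ) + 2) * ((d : ℚ) + 3)) -
        1 / ((U.card : ℚ) + 1) + 1 / ((U.card : ℚ) + (k : ℚ) + 1) +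
        (1 / (((D.card : ℚ) + 1) * ((D.card : ℚ) + 2)) -
          1 / (((U'.card : ℚ) + 2) * ((U'.card : ℚ) + 1))) =
        x + ((k + 1 : ℕ) : ℚ) / (((d : ℚ) + 2) * ((d : ℚ) + 3)) -
          1 / ((U.card : ℚ) + 1) + 1 / ((U.card : ℚ) + ((k + 1 : ℕ) : ℚ) + 1) := by
      intro x
      rw [hD, hcard]
      push_cast
      have e1 : ((d : ℚ) + 1 + 1) * ((d : ℚ) + 1 + 2) = ((d : ℚ) + 2) * ((d : ℚ) + 3) := by ring
      have e2 : 1 / (((U.card : ℚ) + k + 2) * ((U.card : ℚ) + k + 1)) =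
          1 / ((U.card : ℚ) + k + 1) - 1 / ((U.card : ℚ) + (k + 1) + 1) := by
        field_simp
        ring
      rw [e1, e2, add_div]
      ring
    refine ⟨insert v U', ?_, ?_, hst.hasFullCycles hN (by omega) hD, ?_, ?_, ?_⟩
    · rw [Finset.coe_insert, hU', hst.vertexSet_eq (by omega)]
    · rw [Finset.card_insert_of_notMem hvU, hcard, add_assoc]
    · rw [hst.tau_zero (by omega) hU', h0, harith]
    · intro hz
      refine ⟨hst.exists_cycle_ne_zero hN hD (hor hz).1, ?_⟩
      rw [hst.tau_codim_one hN (hor hz).1 hd hD hU', (hor hz).2, harith]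
    · intro i hi hi'
      rw [hst.tau_middle hU' hi (by omega), hmid i hi hi']

end PreAbstractSimplicialComplex

end

theorem mainTheorem3 {α : Type*} [LinearOrder α] (𝕜 : Type*) [Field 𝕜]
    (d n k : ℕ) (hd : 2 ≤ d) (M N : PreAbstractSimplicialComplex α)
    (hM : M.IsCombinatorialManifold d) (hn : M.vertexSet.ncard = n)
    (hN : PreAbstractSimplicialComplex.ObtainedByFlips 1 (d + 1) M k N)
    (V V' : Finset α) (hV : M.vertexSet ⊆ V) (hV' : N.vertexSet ⊆ V') :
    (N.tau 𝕜 V' 0 =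
      M.tau 𝕜 V 0 + (k : ℚ) / (((d : ℚ) + 2) * ((d : ℚ) + 3)) - 1 / ((n : ℚ) + 1)
        + 1 / ((n : ℚ) + (k : ℚ) + 1)) ∧
    (M.IsOrientable 𝕜 d →
      N.tau 𝕜 V' ((d : ℤ) - 1) =
        M.tau 𝕜 V ((d : ℤ) - 1) + (k : ℚ) / (((d : ℚ) + 2) * ((d : ℚ) + 3)) - 1 / ((n : ℚ) + 1)
          + 1 / ((n : ℚ) + (k : ℚ) + 1)) ∧
    (∀ i : ℤ, 1 ≤ i → i ≤ (d : ℤ) - 2 → N.tau 𝕜 V' i = M.tau 𝕜 V i) := by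
  have hfull : M.HasFullCycles 𝕜 d := hM.toIsPseudoManifold.hasFullCycles (by omega)
  obtain ⟨U, hU⟩ : ∃ U : Finset α, (U : Set α) = M.vertexSet :=
    ⟨(PreAbstractSimplicialComplex.finite_vertexSet hM.finite).toFinset, Set.Finite.coe_toFinset _⟩
  have hUn : U.card = n := by rw [← hn, ← hU, Set.ncard_coe_finset]
  obtain ⟨U', hU', -, -, h0, hor, hmid⟩ := hN.tau_eq hd hfull hU
  -- The arbitrary ground sets `V` and `V'` are traded for the vertex sets.
  have hMtau := fun i => PreAbstractSimplicialComplex.tau_eq_of_subset (𝕜 := 𝕜) (K := M) hU.superset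
    (Finset.coe_subset.mp (hU.subset.trans hV)) i
  have hNtau := fun i => PreAbstractSimplicialComplex.tau_eq_of_subset (𝕜 := 𝕜) (K := N) hU'.superset
    (Finset.coe_subset.mp (hU'.subset.trans hV')) i
  simp only [hMtau, hNtau, ← hUn]
  exact ⟨h0, fun h => (hor (h.exists_cycle_ne_zero hM.toIsPseudoManifold)).2, hmid⟩
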